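/- For $n\in\mathbb Z$ let $$f_n(x)=x^6+(3n+4)x^4+(3n+1)x^2-1\quad\text{and}\quad D_n=9n^2+15n+13 .$$ A monic polynomial $f\in\mathbb Z[x]$ of degree $N$, irreducible over $\mathbb Q$, is called monogenic if $\{1,\theta,\dots,\theta^{N-1}\}$ is a $\mathbb Z$-basis of the ring of integers of $\mathbb Q(\theta)$, where $f(\theta)=0$. Then: 1. for every $n\in\mathbb Z$, $f_n$ is irreducible over $\mathbb Q$, and its Galois group over $\mathbb Q$ (that of its splitting field) is isomorphic to the alternating group $A_4$; 2. for every $n\in\mathbb Z$, $f_n$ is monogenic if and only if $D_n$ is squarefree; 3. the set $\mathcal F=\{f_n : n\in\mathbb Z,\ D_n \text{ squarefree}\}$ is infinite; every element of $\mathcal F$ is a monogenic even sextic quadrinomial (a polynomial of degree $6$ with exactly four nonzero terms, all of even degree) with Galois group isomorphic to $A_4$; and no two distinct elements of $\mathcal F$ generate the same sextic field, that is, if $f,g\in\mathcal F$, $f\neq g$, $f(\theta)=0$ and $g(\eta)=0$ with $\theta,\eta\in\mathbb C$, then $\mathbb Q(\theta)$ and $\mathbb Q(\eta)$ are not isomorphic.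 -/

import Mathlib

open Polynomial NumberField IntermediateField

/-- The even sextic `f_n(x) = x^6 + (3n+4) x^4 + (3n+1) x^2 - 1`. -/
noncomputable def evenSextic (n : ℤ) : ℤ[X] :=
  X ^ 6 + C (3 * n + 4) * X ^ 4 + C (3 * n + 1) * X ^ 2 - 1

/-- The integer `9n^2 + 15n + 13`. -/
def sexticD (n : ℤ) : ℤ := 9 * n ^ 2 + 15 * n + 13

/-- An integer polynomial `f` regarded as a polynomial over `ℚ`. -/
noncomputable abbrev overRat (f : ℤ[X]) : ℚ[X] := f.map (Int.castRingHom ℚ)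

/-- `f` is monogenic: it is monic and irreducible over `ℚ`, and, for a root `θ` of `f`, the powers
`1, θ, …, θ^(N-1)`, where `N = deg f`, form a `ℤ`-basis of the ring of integers of `ℚ(θ)`.
(All roots are conjugate, so it does not matter which one is taken; every root is required
to have the property here.) -/
def IsMonogenicPoly (f : ℤ[X]) : Prop :=
  f.Monic ∧ Irreducible (overRat f) ∧
    ∀ θ : ℂ, aeval θ f = 0 →
      ∃ b : Module.Basis (Fin f.natDegree) ℤ (𝓞 ℚ⟮θ⟯),
        ∀ i, (((b i : 𝓞 ℚ⟮θ⟯) : ℚ⟮θ⟯) : ℂ) = θ ^ (i : ℕ)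

/-- The Galois group over `ℚ` of (the splitting field of) `f` is isomorphic to `A_4`. -/
def HasGaloisGroupA4 (f : ℤ[X]) : Prop :=
  Nonempty ((overRat f).Gal ≃* alternatingGroup (Fin 4))

/-- `f` is an even sextic quadrinomial: it has degree six, only terms of even degree, and exactly
four nonzero terms. -/
def IsEvenSexticQuadrinomial (f : ℤ[X]) : Prop :=
  f.natDegree = 6 ∧ (∀ i, Odd i → f.coeff i = 0) ∧ f.support.card = 4

/-- `f` and `g` generate the same field: for some root `θ` of `f` and some root `η` of `g`, the
fields `ℚ(θ)` and `ℚ(η)` are isomorphic. -/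
def GenerateSameField (f g : ℤ[X]) : Prop :=
  ∃ θ η : ℂ, aeval θ f = 0 ∧ aeval η g = 0 ∧ Nonempty (ℚ⟮θ⟯ ≃ₐ[ℚ] ℚ⟮η⟯)

/-- The set of the `f_n` for which `9n^2 + 15n + 13` is squarefree. -/
def squarefreeFamily : Set ℤ[X] := {f | ∃ n : ℤ, Squarefree (sexticD n) ∧ f = evenSextic n}

/-! Everything rests on f_n(x) = g_n(x²), where the roots of the cubic g_n are permuted cyclically
by y ↦ -1/(1+y). Hence g_n defines a cyclic cubic field, and its discriminant is D_n²
(`resolventCubic_conj`, `resolventCubic_vandermonde`).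

Monogenicity. The element z = 3y + (3n+4) satisfies z³ = D_n(3z - (6n+5)), and D_n is coprime to 3
and to 6n+5. So g_n behaves like an Eisenstein polynomial at each prime dividing a squarefree D_n,
and ℤ[y] is the full ring of integers. For u + θv in the sextic field, the conjugation θ ↦ -θ shows
that 2u and 2v lie in ℤ[y]; integrality of u² - yv² and a check modulo 4 remove the 2. Conversely,
if x² ∣ D_n, then z²/x is integral, and its θ⁴-coefficient 9/x forces x to be a unit.

Galois group. With square roots θᵢ of the roots of g_n normalized by θ₁θ₂θ₃ = 1, the four sums
±θ₁±θ₂±θ₃ with an even number of minus signs are the roots of a rational quartic, so the group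
embeds in S₄. Its order is a multiple of 6. Order 6 is impossible because f_n has both a real and a
nonreal root; order 24 is impossible because θ₁² determines θ₂².

Distinct fields. f_n'(θ)³ is 8D_n² times a unit. When ℤ[θ] is the maximal order, the field therefore
determines D_n, and D_n determines n.

Infinitude. A prime p dividing D_n is 1 modulo 6, and p² ∣ D_n confines n to two classes modulo p².
Summing over p leaves a positive proportion of n in a symmetric interval. -/

/-- The cubic `g_n(y) = y^3 + (3n+4) y^2 + (3n+1) y - 1`, for which `f_n(x) = g_n(x^2)`. -/
noncomputable def resolventCubic (n : ℤ) : ℤ[X] :=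
  X ^ 3 + C (3 * n + 4) * X ^ 2 + C (3 * n + 1) * X - 1

/-! ### Basic properties and irreducibility -/

theorem evenSextic_natDegree (n : ℤ) : (evenSextic n).natDegree = 6 := by
  unfold evenSextic; compute_degree!

theorem evenSextic_monic (n : ℤ) : (evenSextic n).Monic := by
  unfold evenSextic; monicity!

theorem resolventCubic_natDegree (n : ℤ) : (resolventCubic n).natDegree = 3 := by
  unfold resolventCubic; compute_degree!

theorem resolventCubic_monic (n : ℤ) : (resolventCubic n).Monic := by
  unfold resolventCubic; monicity!

theorem aeval_evenSextic {A : Type*} [CommRing A] [Algebra ℤ A] (n : ℤ) (t : A) :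
    aeval t (evenSextic n) = t ^ 6 + (3 * n + 4) * t ^ 4 + (3 * n + 1) * t ^ 2 - 1 := by
  simp [evenSextic, map_ofNat]

theorem aeval_resolventCubic {A : Type*} [CommRing A] [Algebra ℤ A] (n : ℤ) (t : A) :
    aeval t (resolventCubic n) = t ^ 3 + (3 * n + 4) * t ^ 2 + (3 * n + 1) * t - 1 := by
  simp [resolventCubic, map_ofNat]

theorem aeval_overRat {A : Type*} [Field A] [Algebra ℚ A] (f : ℤ[X]) (t : A) :
    aeval t (overRat f) = aeval t f := by
  have : overRat f = f.map (algebraMap ℤ ℚ) := rfl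
  rw [this, aeval_map_algebraMap]

theorem exists_eq_X_add_C_of_monic {f : ℤ[X]} (hf : f.Monic) (h : f.natDegree = 1) :
    ∃ c, f = X + C c := by
  refine ⟨f.coeff 0, ?_⟩
  conv_lhs => rw [hf.as_sum, h]
  simp

theorem resolventCubic_irreducible (n : ℤ) : Irreducible (resolventCubic n) := by
  rw [(resolventCubic_monic n).irreducible_iff_natDegree']
  refine ⟨fun h => by simpa [h] using resolventCubic_natDegree n, fun g f _ hf hfg hd => ?_⟩
  rw [mul_comm] at hfg
  rw [resolventCubic_natDegree, Finset.mem_Ioc] at hd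
  obtain ⟨c, rfl⟩ := exists_eq_X_add_C_of_monic hf (by omega)
  have h0 : aeval (-c) (resolventCubic n) = 0 := by rw [← hfg]; simp
  rw [aeval_resolventCubic] at h0
  push_cast at h0
  rcases Int.eq_one_or_neg_one_of_mul_eq_one
    (u := c) (v := - c ^ 2 + (3 * n + 4) * c - (3 * n + 1)) (by simp at h0; linarith) with h | h
  · subst h; simp at h0
    omega
  · subst h; simp at h0; omega

theorem evenSextic_irreducible (n : ℤ) : Irreducible (evenSextic n) := by
  rw [(evenSextic_monic n).irreducible_iff_natDegree']
  refine ⟨fun h => by simpa [h] using evenSextic_natDegree n, fun g f hg hf hfg hd => ?_⟩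
  have hdeg := evenSextic_natDegree n
  rw [mul_comm] at hfg
  rw [hdeg, Finset.mem_Ioc] at hd
  rw [← hfg, hf.natDegree_mul hg] at hdeg
  have hd' : f.natDegree = 1 ∨ f.natDegree = 2 ∨ f.natDegree = 3 := by omega
  rcases hd' with h | h | h
  · obtain ⟨c, rfl⟩ := exists_eq_X_add_C_of_monic hf h
    have h0 : aeval (-c) (evenSextic n) = 0 := by rw [← hfg]; simp
    rw [aeval_evenSextic] at h0
    push_cast at h0
    rcases Int.eq_one_or_neg_one_of_mul_eq_one
      (u := c) (v := c ^ 5 + (3 * n + 4) * c ^ 3 + (3 * n + 1) * c)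
      (by simp at h0; linarith) with h | h
    · subst h; simp at h0
      omega
    · subst h; simp at h0; omega
  · have hg4 : g.natDegree = 4 := by omega
    obtain ⟨a, b, hf'⟩ : ∃ a b, f = X ^ 2 + C a * X + C b := ⟨f.coeff 1, f.coeff 0, by
      conv_lhs => rw [hf.as_sum, h]
      simp [Finset.sum_range_succ]; ring⟩
    obtain ⟨c, d, e, k, hg'⟩ : ∃ c d e k, g = X ^ 4 + C c * X ^ 3 + C d * X ^ 2 + C e * X + C k :=
      ⟨g.coeff 3, g.coeff 2, g.coeff 1, g.coeff 0, by
      conv_lhs => rw [hg.as_sum, hg4]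
      simp [Finset.sum_range_succ]; ring⟩
    have key : evenSextic n = C 1 * X ^ 6 + C (a + c) * X ^ 5 + C (b + a * c + d) * X ^ 4
        + C (a * d + b * c + e) * X ^ 3 + C (a * e + b * d + k) * X ^ 2 + C (a * k + b * e) * X ^ 1
        + C (b * k) * X ^ 0 := by
      rw [← hfg, hf', hg']; simp only [map_add, map_mul, map_one]; ring
    have e5 := congrArg (coeff · 5) key
    have e4 := congrArg (coeff · 4) key
    have e3 := congrArg (coeff · 3) key
    have e2 := congrArg (coeff · 2) key
    have e1 := congrArg (coeff · 1) key
    have e0 := congrArg (coeff · 0) key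
    simp only [evenSextic, coeff_add, coeff_sub, coeff_C_mul, coeff_X_pow, coeff_one] at e5 e4 e3 e2 e1 e0
    norm_num at e5 e4 e3 e2 e1 e0
    obtain rfl : c = -a := by linarith
    rcases Int.eq_one_or_neg_one_of_mul_eq_one (u := b) (v := -k) (by linarith) with hb | hb
    · subst hb
      obtain rfl : k = -1 := by linarith
      obtain rfl : e = a := by linarith
      have : e * d = 0 := by linarith
      rcases mul_eq_zero.1 this with h | h
      · subst h; omega
      · subst h
        have : 2 * (e * e) = -1 := by linarith
        omega
    · subst hb
      obtain rfl : k = 1 := by linarith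
      obtain rfl : e = a := by linarith
      have : e * (d + 2) = 0 := by linarith
      rcases mul_eq_zero.1 this with h | h
      · subst h; omega
      · obtain rfl : d = -2 := by linarith
        have : 6 * n + 5 = 0 := by linarith
        omega
  · have hg3 : g.natDegree = 3 := by omega
    have cub : ∀ f : ℤ[X], f.Monic → f.natDegree = 3 →
        ∃ a b c, f = X ^ 3 + C a * X ^ 2 + C b * X + C c := fun f hf h =>
      ⟨f.coeff 2, f.coeff 1, f.coeff 0, by
      conv_lhs => rw [hf.as_sum, h]
      simp [Finset.sum_range_succ]; ring⟩
    obtain ⟨a, b, c, hf'⟩ := cub f hf h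
    obtain ⟨d, e, k, hg'⟩ := cub g hg hg3
    have key : evenSextic n = C 1 * X ^ 6 + C (a + d) * X ^ 5 + C (b + a * d + e) * X ^ 4
        + C (c + k + a * e + b * d) * X ^ 3 + C (a * k + b * e + c * d) * X ^ 2
        + C (b * k + c * e) * X ^ 1 + C (c * k) * X ^ 0 := by
      rw [← hfg, hf', hg']; simp only [map_add, map_mul, map_one]; ring
    have e5 := congrArg (coeff · 5) key
    have e4 := congrArg (coeff · 4) key
    have e3 := congrArg (coeff · 3) key
    have e2 := congrArg (coeff · 2) key
    have e1 := congrArg (coeff · 1) key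
    have e0 := congrArg (coeff · 0) key
    simp only [evenSextic, coeff_add, coeff_sub, coeff_C_mul, coeff_X_pow, coeff_one] at e5 e4 e3 e2 e1 e0
    norm_num at e5 e4 e3 e2 e1 e0
    obtain rfl : d = -a := by linarith
    rcases Int.eq_one_or_neg_one_of_mul_eq_one (u := c) (v := -k) (by linarith) with hb | hb
    · subst hb
      obtain rfl : k = -1 := by linarith
      obtain rfl : e = b := by linarith
      -- Subtracting `e2` from `e4` gives (a-1)² + (e-1)² = -1; in the other sign case a-1 becomes
      -- a+1.
      nlinarith [sq_nonneg (a - 1), sq_nonneg (e - 1), sq_nonneg (a + 1), sq_nonneg (e + 1)]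
    · subst hb
      obtain rfl : k = 1 := by linarith
      obtain rfl : e = b := by linarith
      nlinarith [sq_nonneg (a - 1), sq_nonneg (e - 1), sq_nonneg (a + 1), sq_nonneg (e + 1)]

theorem overRat_irreducible {f : ℤ[X]} (hm : f.Monic) (hi : Irreducible f) :
    Irreducible (overRat f) :=
  (hm.irreducible_iff_irreducible_map_fraction_map (K := ℚ)).1 hi

theorem minpoly_rat_eq_overRat {A : Type*} [Field A] [Algebra ℚ A] {f : ℤ[X]} (hm : f.Monic)
    (hi : Irreducible f) {t : A} (h : aeval t f = 0) : minpoly ℚ t = overRat f :=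
  (minpoly.eq_of_irreducible_of_monic (overRat_irreducible hm hi)
    (by rw [aeval_overRat, h]) (hm.map _)).symm

theorem minpoly_int_eq {A : Type*} [Field A] [Algebra ℚ A] {f : ℤ[X]} (hm : f.Monic)
    (hi : Irreducible f) {t : A} (h : aeval t f = 0) : minpoly ℤ t = f := by
  have h1 := minpoly.isIntegrallyClosed_eq_field_fractions' (R := ℤ) ℚ (s := t) ⟨f, hm, h⟩
  rw [minpoly_rat_eq_overRat hm hi h] at h1
  exact (map_injective _ (algebraMap ℤ ℚ).injective_int h1).symm

theorem evenSextic_isEvenSexticQuadrinomial (n : ℤ) : IsEvenSexticQuadrinomial (evenSextic n) := by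
  have hc : ∀ i, (evenSextic n).coeff i = if i = 6 then 1 else if i = 4 then 3 * n + 4 else
      if i = 2 then 3 * n + 1 else if i = 0 then -1 else 0 := by
    intro i
    simp only [evenSextic, coeff_add, coeff_sub, coeff_C_mul, coeff_X_pow, coeff_one]
    split_ifs <;> simp_all
  refine ⟨evenSextic_natDegree n, fun i hi => ?_, ?_⟩
  · rw [hc]
    rcases hi with ⟨k, rfl⟩
    split_ifs <;> first | rfl | omega
  · have : (evenSextic n).support = {0, 2, 4, 6} := by
      ext i
      rw [mem_support_iff, hc]
      simp only [Finset.mem_insert, Finset.mem_singleton]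
      split_ifs <;> constructor <;> intro h <;> omega
    rw [this]; rfl

theorem evenSextic_injective : Function.Injective evenSextic := by
  intro n m h
  have := congrArg (aeval (1 : ℤ)) h
  simp only [aeval_evenSextic] at this
  push_cast at this
  simp at this
  linarith

/-! ### Conjugates, arithmetic of D_n, and the cyclic cubic -/

/-- If q is monic with q(P(t)) = 0, the minimal polynomial of t divides q ∘ P, so q also kills P(s).
-/
theorem isIntegral_aeval_of_conj {t s : ℂ} (hs : aeval s (minpoly ℚ t) = 0) (P : ℚ[X])
    (h : IsIntegral ℤ (aeval t P)) : IsIntegral ℤ (aeval s P) := by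
  obtain ⟨q, hq, hq0⟩ := h
  refine ⟨q, hq, ?_⟩
  rw [← aeval_def] at hq0 ⊢
  have key : ∀ z : ℂ, aeval z ((overRat q).comp P) = aeval (aeval z P) q := fun z => by
    rw [aeval_comp, aeval_overRat]
  rw [← key] at hq0 ⊢
  exact aeval_eq_zero_of_dvd_aeval_eq_zero (minpoly.dvd ℚ t hq0) hs

theorem exists_intCast_of_isIntegral {q : ℚ} (h : IsIntegral ℤ (q : ℂ)) : ∃ m : ℤ, q = m := by
  have h' : IsIntegral ℤ (algebraMap ℚ ℂ q) := by simpa using h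
  rw [isIntegral_algebraMap_iff (algebraMap ℚ ℂ).injective,
    IsIntegrallyClosed.isIntegral_iff (R := ℤ)] at h'
  obtain ⟨m, hm⟩ := h'
  exact ⟨m, by simpa using hm.symm⟩

theorem isIntegral_intCast_complex (m : ℤ) : IsIntegral ℤ (m : ℂ) := by
  simpa using (isIntegral_algebraMap (R := ℤ) (A := ℂ) (x := m))

theorem sexticD_coprime_three (n : ℤ) : IsCoprime (sexticD n) 3 :=
  ⟨1, -(3 * n ^ 2 + 5 * n + 4), by unfold sexticD; ring⟩

/-- 4D_n - (6n+5)² = 27, a power of 3. -/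
theorem sexticD_coprime_linear (n : ℤ) : IsCoprime (sexticD n) ((6 * n + 5) ^ 2) := by
  obtain ⟨u, v, h⟩ := (sexticD_coprime_three n).pow_right (n := 3)
  exact ⟨u + 4 * v, -v, by unfold sexticD at *; linear_combination h⟩

theorem sexticD_pos (n : ℤ) : 0 < sexticD n := by
  unfold sexticD; nlinarith [sq_nonneg (6 * n + 5)]

theorem sexticD_ne_zero_complex (n : ℤ) : ((sexticD n : ℤ) : ℂ) ≠ 0 := by
  exact_mod_cast (sexticD_pos n).ne'

/-- The two elements are -1/(1+y) and -(1+y)/y, written as polynomials in y by means of the cubic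
relation. -/
theorem resolventCubic_conj {A : Type*} [CommRing A] {n : ℤ} {y : A} (hy : aeval y (resolventCubic n) = 0) :
    aeval (y ^ 2 + (3 * n + 3) * y - 2) (resolventCubic n) = 0 ∧
    aeval (-y ^ 2 - (3 * n + 4) * y - (3 * n + 2)) (resolventCubic n) = 0 := by
  simp only [aeval_resolventCubic] at *
  constructor
  · linear_combination ((-5 + -6*n) + (4 + 15*n + 9*n^2)*y + (5 + 6*n)*y^2 + (1)*y^3) * hy
  · linear_combination ((-5 + -15*n + -9*n^2) + (-17 + -27*n + -9*n^2)*y + (-8 + -6*n)*y^2 + (-1)*y^3) * hy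

theorem resolventCubic_vandermonde {A : Type*} [CommRing A] {n : ℤ} {y : A} (hy : aeval y (resolventCubic n) = 0) :
    (y - (y ^ 2 + (3 * n + 3) * y - 2)) *
    ((y ^ 2 + (3 * n + 3) * y - 2) - (-y ^ 2 - (3 * n + 4) * y - (3 * n + 2))) *
    ((-y ^ 2 - (3 * n + 4) * y - (3 * n + 2)) - y) = -((sexticD n : ℤ) : A) := by
  rw [aeval_resolventCubic] at hy
  unfold sexticD
  push_cast
  linear_combination ((-13 + -3*n + 9*n^2) + (15 + 42*n + 18*n^2)*y + (13 + 12*n)*y^2 + (2)*y^3) * hy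

/-! ### Integral basis of the cubic field -/

section Cubic

variable {n : ℤ} {y : ℂ}

theorem isIntegral_of_resolventCubic (hy : aeval y (resolventCubic n) = 0) : IsIntegral ℤ y :=
  ⟨_, resolventCubic_monic n, hy⟩

theorem isIntegral_aeval_of_resolventCubic {s : ℂ} (hy : aeval y (resolventCubic n) = 0)
    (hs : aeval s (resolventCubic n) = 0) (P : ℚ[X]) (h : IsIntegral ℤ (aeval y P)) :
    IsIntegral ℤ (aeval s P) := by
  refine isIntegral_aeval_of_conj ?_ P h
  rw [minpoly_rat_eq_overRat (resolventCubic_monic n) (resolventCubic_irreducible n) hy,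
    aeval_overRat, hs]

/-- The discriminant bound: `D_n` annihilates the quotient of the ring of integers by `ℤ[y]`. -/
theorem exists_sexticD_mul_eq_intCast (hy : aeval y (resolventCubic n) = 0) {A B C : ℚ}
    (h : IsIntegral ℤ (A + B * y + C * y ^ 2 : ℂ)) :
    ∃ a b c : ℤ, sexticD n * A = a ∧ sexticD n * B = b ∧ sexticD n * C = c := by
  obtain ⟨h2, h3⟩ := resolventCubic_conj hy
  have hV := resolventCubic_vandermonde hy
  set y₂ := y ^ 2 + (3 * n + 3) * y - 2
  set y₃ := -y ^ 2 - (3 * n + 4) * y - (3 * n + 2)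
  have key : ∀ s : ℂ, aeval s (resolventCubic n) = 0 →
      IsIntegral ℤ (A + B * s + C * s ^ 2 : ℂ) := fun s hs => by
    have := isIntegral_aeval_of_resolventCubic hy hs
      (Polynomial.C A + Polynomial.C B * X + Polynomial.C C * X ^ 2) (by simpa using h)
    simpa using this
  have i1 := isIntegral_of_resolventCubic hy
  have i2 := isIntegral_of_resolventCubic h2
  have i3 := isIntegral_of_resolventCubic h3
  have k2 := key _ h2
  have k3 := key _ h3
  refine ⟨_, _, _, (exists_intCast_of_isIntegral ?_).choose_spec,
    (exists_intCast_of_isIntegral ?_).choose_spec, (exists_intCast_of_isIntegral ?_).choose_spec⟩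
  -- Cramer's rule for the system given by the three conjugates, whose Vandermonde determinant is
  -- D_n up to sign; the same method gives B and C.
  · have : ((sexticD n * A : ℚ) : ℂ) = (A + B * y + C * y ^ 2) * (y₂ * y₃ * (y₂ - y₃))
        + (A + B * y₂ + C * y₂ ^ 2) * (y₃ * y * (y₃ - y))
        + (A + B * y₃ + C * y₃ ^ 2) * (y * y₂ * (y - y₂)) := by
      push_cast; linear_combination (A : ℂ) * hV
    rw [this]
    exact ((h.mul ((i2.mul i3).mul (i2.sub i3))).add (k2.mul ((i3.mul i1).mul (i3.sub i1)))).add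
      (k3.mul ((i1.mul i2).mul (i1.sub i2)))
  · have : ((sexticD n * B : ℚ) : ℂ) = -((A + B * y + C * y ^ 2) * (y₂ ^ 2 - y₃ ^ 2)
        + (A + B * y₂ + C * y₂ ^ 2) * (y₃ ^ 2 - y ^ 2)
        + (A + B * y₃ + C * y₃ ^ 2) * (y ^ 2 - y₂ ^ 2)) := by
      push_cast; linear_combination (B : ℂ) * hV
    rw [this]
    exact (((h.mul ((i2.pow 2).sub (i3.pow 2))).add (k2.mul ((i3.pow 2).sub (i1.pow 2)))).add
      (k3.mul ((i1.pow 2).sub (i2.pow 2)))).neg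
  · have : ((sexticD n * C : ℚ) : ℂ) = ((A + B * y + C * y ^ 2) * (y₂ - y₃)
        + (A + B * y₂ + C * y₂ ^ 2) * (y₃ - y)
        + (A + B * y₃ + C * y₃ ^ 2) * (y - y₂)) := by
      push_cast; linear_combination (C : ℂ) * hV
    rw [this]
    exact ((h.mul (i2.sub i3)).add (k2.mul (i3.sub i1))).add (k3.mul (i1.sub i2))

theorem traceZero_cube (hy : aeval y (resolventCubic n) = 0) :
    (3 * y + (3 * n + 4)) ^ 3 =
      ((sexticD n : ℤ) : ℂ) * (3 * (3 * y + (3 * n + 4)) - (6 * n + 5)) := by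
  rw [aeval_resolventCubic] at hy
  unfold sexticD
  push_cast
  linear_combination (27 : ℂ) * hy

/-- Take norms: z = 3y + (3n+4) has norm -D_n(6n+5), so b z²/D_n has norm b³(6n+5)²/D_n. This is an
integer, and D_n is squarefree and coprime to (6n+5)². -/
theorem sexticD_dvd_of_isIntegral (hD : Squarefree (sexticD n))
    (hy : aeval y (resolventCubic n) = 0) {b : ℤ}
    (h : IsIntegral ℤ (b * (3 * y + (3 * n + 4)) ^ 2 / (sexticD n : ℤ) : ℂ)) :
    sexticD n ∣ b := by
  obtain ⟨h2, h3⟩ := resolventCubic_conj hy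
  have key : ∀ s : ℂ, aeval s (resolventCubic n) = 0 →
      IsIntegral ℤ (b * (3 * s + (3 * n + 4)) ^ 2 / (sexticD n : ℤ) : ℂ) := fun s hs => by
    have e : ∀ s : ℂ, aeval s (C (b / sexticD n : ℚ) * (C 3 * X + C (3 * n + 4 : ℚ)) ^ 2) =
        (b * (3 * s + (3 * n + 4)) ^ 2 / (sexticD n : ℤ) : ℂ) := fun s => by
      simp; ring
    have := isIntegral_aeval_of_resolventCubic hy hs
      (C (b / sexticD n : ℚ) * (C 3 * X + C (3 * n + 4 : ℚ)) ^ 2) (by rwa [e])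
    rwa [e] at this
  have hp := (h.mul (key _ h2)).mul (key _ h3)
  have hD0 := sexticD_ne_zero_complex n
  set y₂ := y ^ 2 + (3 * n + 3) * y - 2 with hy₂
  set y₃ := -y ^ 2 - (3 * n + 4) * y - (3 * n + 2) with hy₃
  have hprod : (3 * y + (3 * n + 4)) * (3 * y₂ + (3 * n + 4)) * (3 * y₃ + (3 * n + 4)) =
      -((sexticD n : ℤ) : ℂ) * (6 * n + 5) := by
    rw [aeval_resolventCubic] at hy
    unfold sexticD
    push_cast
    linear_combination ((-81 + -189*n + -81*n^2) + (-117 + -108*n)*y + (-27)*y^2) * hy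
  have hq : ((b ^ 3 * (6 * n + 5) ^ 2 / sexticD n : ℚ) : ℂ) =
      b * (3 * y + (3 * n + 4)) ^ 2 / (sexticD n : ℤ) * (b * (3 * y₂ + (3 * n + 4)) ^ 2 /
        (sexticD n : ℤ)) * (b * (3 * y₃ + (3 * n + 4)) ^ 2 / (sexticD n : ℤ)) := by
    have : ((3 * y + (3 * n + 4)) * (3 * y₂ + (3 * n + 4)) * (3 * y₃ + (3 * n + 4))) ^ 2 =
      ((sexticD n : ℤ) : ℂ) ^ 2 * (6 * n + 5) ^ 2 := by rw [hprod]; ring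
    push_cast
    field_simp
    linear_combination (-(b : ℂ) ^ 3) * this
  rw [← hq] at hp
  obtain ⟨m, hm⟩ := exists_intCast_of_isIntegral hp
  have hDq : (sexticD n : ℚ) ≠ 0 := by exact_mod_cast (sexticD_pos n).ne'
  rw [div_eq_iff hDq] at hm
  have hdvd : sexticD n ∣ b ^ 3 * (6 * n + 5) ^ 2 := ⟨m, by
    have : ((b ^ 3 * (6 * n + 5) ^ 2 : ℤ) : ℚ) = (sexticD n * m : ℤ) := by
      push_cast; linear_combination hm
    exact_mod_cast this⟩
  exact (hD.dvd_pow_iff_dvd three_ne_zero).1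
    ((sexticD_coprime_linear n).dvd_of_dvd_mul_right hdvd)

/-- If `D_n` is squarefree, then `1, y, y^2` is an integral basis of the cubic field `ℚ(y)`. -/
theorem exists_eq_intCast_of_isIntegral_cubic (hD : Squarefree (sexticD n))
    (hy : aeval y (resolventCubic n) = 0) {A B C : ℚ}
    (h : IsIntegral ℤ (A + B * y + C * y ^ 2 : ℂ)) :
    ∃ a b c : ℤ, A = a ∧ B = b ∧ C = c := by
  obtain ⟨a, b, c, ha, hb, hc⟩ := exists_sexticD_mul_eq_intCast hy h
  have hD0 := sexticD_ne_zero_complex n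
  have hDq : (sexticD n : ℚ) ≠ 0 := by exact_mod_cast (sexticD_pos n).ne'
  have hz3 := traceZero_cube hy
  have iy := isIntegral_of_resolventCubic hy
  have iint := isIntegral_intCast_complex
  set z : ℂ := 3 * y + (3 * n + 4) with hz
  have iz : IsIntegral ℤ z := by
    have : z = (3 : ℤ) * y + ((3 * n + 4 : ℤ) : ℂ) := by rw [hz]; push_cast; ring
    rw [this]; exact ((iint _).mul iy).add (iint _)
  have iw : IsIntegral ℤ (3 * z - (6 * n + 5)) := by
    have : 3 * z - (6 * n + 5) = (3 : ℤ) * z - ((6 * n + 5 : ℤ) : ℂ) := by push_cast; ring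
    rw [this]; exact ((iint _).mul iz).sub (iint _)
  set w : ℂ := 3 * z - (6 * n + 5) with hw
  -- Coefficients of 9D_n(A + By + Cy²) in powers of z, using 3y = z - (3n+4).
  obtain ⟨b₀, hb₀⟩ : ∃ b₀ : ℤ, b₀ = 9 * a - 3 * (3 * n + 4) * b + (3 * n + 4) ^ 2 * c := ⟨_, rfl⟩
  obtain ⟨b₁, hb₁⟩ : ∃ b₁ : ℤ, b₁ = 3 * b - 2 * (3 * n + 4) * c := ⟨_, rfl⟩
  have i9 : IsIntegral ℤ ((b₀ + b₁ * z + c * z ^ 2) / (sexticD n : ℤ) : ℂ) := by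
    have : ((b₀ + b₁ * z + c * z ^ 2) / (sexticD n : ℤ) : ℂ) =
        (9 : ℤ) * (A + B * y + C * y ^ 2) := by
      have ha' : (sexticD n * A : ℂ) = a := by exact_mod_cast congrArg (Rat.cast (K := ℂ)) ha
      have hb' : (sexticD n * B : ℂ) = b := by exact_mod_cast congrArg (Rat.cast (K := ℂ)) hb
      have hc' : (sexticD n * C : ℂ) = c := by exact_mod_cast congrArg (Rat.cast (K := ℂ)) hc
      rw [hb₀, hb₁, div_eq_iff hD0]
      push_cast
      rw [← ha', ← hb', ← hc', hz]
      ring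
    rw [this]; exact (iint _).mul h
  -- Since z³/D_n = w is integral, multiplying by z², then z, then 1 isolates b₀z²/D_n, b₁z²/D_n and
  -- cz²/D_n in turn.
  have h0 : sexticD n ∣ b₀ := sexticD_dvd_of_isIntegral hD hy (by
    rw [← hz]
    have : (b₀ * z ^ 2 / (sexticD n : ℤ) : ℂ) =
        (b₀ + b₁ * z + c * z ^ 2) / (sexticD n : ℤ) * z ^ 2 - b₁ * w - c * (w * z) := by
      field_simp
      linear_combination (-b₁ - c * z) * hz3
    rw [this]
    exact ((i9.mul (iz.pow 2)).sub ((iint _).mul iw)).sub ((iint _).mul (iw.mul iz)))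
  obtain ⟨d₀, rfl⟩ := h0
  have h1 : sexticD n ∣ b₁ := sexticD_dvd_of_isIntegral hD hy (by
    rw [← hz]
    have : (b₁ * z ^ 2 / (sexticD n : ℤ) : ℂ) =
        ((sexticD n * d₀ : ℤ) + b₁ * z + c * z ^ 2) / (sexticD n : ℤ) * z - d₀ * z - c * w := by
      push_cast
      field_simp
      linear_combination (-c) * hz3
    rw [this]
    exact ((i9.mul iz).sub ((iint _).mul iz)).sub ((iint _).mul iw))
  obtain ⟨d₁, rfl⟩ := h1
  have h2 : sexticD n ∣ c := sexticD_dvd_of_isIntegral hD hy (by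
    rw [← hz]
    have : (c * z ^ 2 / (sexticD n : ℤ) : ℂ) =
        ((sexticD n * d₀ : ℤ) + (sexticD n * d₁ : ℤ) * z + c * z ^ 2) / (sexticD n : ℤ)
          - d₀ - d₁ * z := by
      push_cast
      field_simp
      ring
    rw [this]
    exact (i9.sub (iint _)).sub ((iint _).mul iz))
  have hcop := sexticD_coprime_three n
  have h1' : sexticD n ∣ b := by
    refine hcop.dvd_of_dvd_mul_left ?_
    have : 3 * b = sexticD n * d₁ + 2 * (3 * n + 4) * c := by linarith
    rw [this]
    exact dvd_add (dvd_mul_right _ _) (h2.mul_left _)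
  have h0' : sexticD n ∣ a := by
    refine (hcop.mul_right hcop).dvd_of_dvd_mul_left ?_
    have : 3 * 3 * a = sexticD n * d₀ + 3 * (3 * n + 4) * b - (3 * n + 4) ^ 2 * c := by linarith
    rw [this]
    exact dvd_sub (dvd_add (dvd_mul_right _ _) (h1'.mul_left _)) (h2.mul_left _)
  obtain ⟨a, rfl⟩ := h0'
  obtain ⟨b, rfl⟩ := h1'
  obtain ⟨c, rfl⟩ := h2
  push_cast at ha hb hc
  exact ⟨a, b, c, mul_left_cancel₀ hDq ha, mul_left_cancel₀ hDq hb, mul_left_cancel₀ hDq hc⟩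

end Cubic

/-! ### Monogenicity in terms of rational coordinates -/

section PowerBasis

variable {f : ℤ[X]} {θ : ℂ}

theorem exists_eq_sum_pow_of_mem_adjoin (hm : f.Monic) (hi : Irreducible f) (hθ : aeval θ f = 0)
    {x : ℂ} (hx : x ∈ ℚ⟮θ⟯) : ∃ c : Fin f.natDegree → ℚ, x = ∑ i, (c i : ℂ) * θ ^ (i : ℕ) := by
  have hint : IsIntegral ℚ θ := ⟨overRat f, hm.map _, by rw [← aeval_def, aeval_overRat, hθ]⟩
  rw [← mem_toSubalgebra, adjoin_simple_toSubalgebra_of_isAlgebraic hint.isAlgebraic,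
    Algebra.adjoin_singleton_eq_range_aeval] at hx
  obtain ⟨P, rfl⟩ := hx
  have hmm := hm.map (Int.castRingHom ℚ)
  have hd : (P %ₘ overRat f).natDegree < f.natDegree := by
    have h1 : f.natDegree ≠ 0 := fun h => hi.not_isUnit (by
      rw [hm.natDegree_eq_zero.1 h]; exact isUnit_one)
    have h2 : (overRat f).natDegree = f.natDegree := hm.natDegree_map _
    rw [← h2]
    exact natDegree_modByMonic_lt P hmm (fun h => h1 (by rw [← h2, h, natDegree_one]))
  refine ⟨fun i => (P %ₘ overRat f).coeff i, ?_⟩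
  have hP : aeval θ P = aeval θ (P %ₘ overRat f) := by
    conv_lhs => rw [← modByMonic_add_div P (overRat f)]
    simp [aeval_overRat, hθ]
  change aeval θ P = _
  rw [hP, aeval_eq_sum_range' hd, Finset.sum_range]
  simp [Algebra.smul_def]

theorem eq_zero_of_sum_pow_eq_zero (hm : f.Monic) (hi : Irreducible f) (hθ : aeval θ f = 0)
    {c : Fin f.natDegree → ℚ} (h : ∑ i, (c i : ℂ) * θ ^ (i : ℕ) = 0) (i : Fin f.natDegree) :
    c i = 0 := by
  have hN : (minpoly ℚ θ).natDegree = f.natDegree := by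
    rw [minpoly_rat_eq_overRat hm hi hθ, hm.natDegree_map]
  have := linearIndependent_pow (K := ℚ) θ
  rw [hN] at this
  exact Fintype.linearIndependent_iff.1 this c (by simpa [Algebra.smul_def] using h) i

/-- Replaces the basis of the ring of integers by a condition on complex numbers: an integral
rational combination of 1, θ, …, θ^(N-1) has integer coefficients. The powers are linearly
independent and span ℚ(θ), so the two agree. -/
theorem isMonogenicPoly_iff (f : ℤ[X]) : IsMonogenicPoly f ↔
    f.Monic ∧ Irreducible f ∧ ∀ θ : ℂ, aeval θ f = 0 → ∀ c : Fin f.natDegree → ℚ,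
      IsIntegral ℤ (∑ i, (c i : ℂ) * θ ^ (i : ℕ)) → ∀ i, ∃ m : ℤ, c i = m := by
  unfold IsMonogenicPoly
  refine and_congr_right fun hm => ?_
  have hirr : Irreducible (overRat f) ↔ Irreducible f :=
    (hm.irreducible_iff_irreducible_map_fraction_map (K := ℚ)).symm
  rw [hirr]
  refine and_congr_right fun hi => forall₂_congr fun θ hθ => ?_
  have hval : ∀ x : ℚ⟮θ⟯, IsIntegral ℤ x ↔ IsIntegral ℤ (x : ℂ) := fun x =>
    (isIntegral_algebraMap_iff (R := ℤ) (A := ℚ⟮θ⟯) (B := ℂ) (algebraMap ℚ⟮θ⟯ ℂ).injective).symm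
  have hθmem : θ ∈ ℚ⟮θ⟯ := mem_adjoin_simple_self ℚ θ
  have hpow : ∀ i : ℕ, IsIntegral ℤ (⟨θ ^ i, pow_mem hθmem i⟩ : ℚ⟮θ⟯) := fun i =>
    (hval _).2 (IsIntegral.pow ⟨f, hm, hθ⟩ i)
  constructor
  · rintro ⟨b, hb⟩ c hc i
    have hmem : (∑ i, (c i : ℂ) * θ ^ (i : ℕ)) ∈ ℚ⟮θ⟯ :=
      sum_mem fun i _ => mul_mem ((ℚ⟮θ⟯).algebraMap_mem (c i)) (pow_mem hθmem _)
    let o : 𝓞 ℚ⟮θ⟯ := ⟨⟨_, hmem⟩, (hval _).2 hc⟩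
    have ho : ((o : ℚ⟮θ⟯) : ℂ) = ∑ i, (c i : ℂ) * θ ^ (i : ℕ) := rfl
    have hs : ((o : ℚ⟮θ⟯) : ℂ) = ∑ i, ((b.repr o i : ℚ) : ℂ) * θ ^ (i : ℕ) := by
      conv_lhs => rw [← b.sum_repr o]
      simp [hb]
    refine ⟨b.repr o i, ?_⟩
    have := eq_zero_of_sum_pow_eq_zero hm hi hθ (c := fun i => c i - b.repr o i) (by
      push_cast
      simp only [sub_mul, Finset.sum_sub_distrib]
      rw [← ho, hs]
      simp) i
    linarith
  · intro H
    let v : Fin f.natDegree → 𝓞 ℚ⟮θ⟯ := fun i => ⟨⟨θ ^ (i : ℕ), pow_mem hθmem _⟩, hpow i⟩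
    have hv : ∀ i, ((v i : ℚ⟮θ⟯) : ℂ) = θ ^ (i : ℕ) := fun i => rfl
    have hcast : ∀ g : Fin f.natDegree → ℤ, (((∑ i, g i • v i : 𝓞 ℚ⟮θ⟯) : ℚ⟮θ⟯) : ℂ) =
        ∑ i, ((g i : ℚ) : ℂ) * θ ^ (i : ℕ) := fun g => by simp [hv]
    have hinj : ∀ x y : 𝓞 ℚ⟮θ⟯, ((x : ℚ⟮θ⟯) : ℂ) = ((y : ℚ⟮θ⟯) : ℂ) → x = y := fun x y h =>
      RingOfIntegers.ext (Subtype.ext h)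
    have hli : LinearIndependent ℤ v := Fintype.linearIndependent_iff.2 fun g hg i => by
      have := hcast g
      rw [hg] at this
      have := eq_zero_of_sum_pow_eq_zero hm hi hθ (c := fun i => (g i : ℚ))
        (by rw [← this]; simp) i
      exact_mod_cast this
    have hsp : ⊤ ≤ Submodule.span ℤ (Set.range v) := fun o _ => by
      obtain ⟨c, hc⟩ := exists_eq_sum_pow_of_mem_adjoin hm hi hθ (o : ℚ⟮θ⟯).2
      have hint : IsIntegral ℤ ((o : ℚ⟮θ⟯) : ℂ) := (hval _).1 o.2
      have hint' := hint
      rw [hc] at hint'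
      choose g hg using H c hint'
      have : o = ∑ i, g i • v i := hinj _ _ (by rw [hcast, hc]; simp [hg])
      rw [this]
      exact Submodule.sum_mem _ fun i _ =>
        Submodule.smul_mem _ _ (Submodule.subset_span ⟨i, rfl⟩)
    exact ⟨Module.Basis.mk hli hsp, fun i => by rw [Module.Basis.mk_apply]; rfl⟩

end PowerBasis

/-! ### Integral basis of the sextic field -/

/-- Modulo 4, twice a product depends only on the parities of the factors, and the squares record
these. -/
theorem zmod_four_mul_eq (x y : ZMod 4) :
    2 * x * y = 2 * (x ^ 2) * (y ^ 2) := by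
  revert x y; decide

theorem zmod_four_sq_eq (x : ZMod 4) : x ^ 2 = 0 ∨ x ^ 2 = 1 := by
  revert x; decide

theorem even_of_zmod_four_sq_eq_zero {x : ℤ} (h : (x : ZMod 4) ^ 2 = 0) : Even x := by
  have : ((x ^ 2 : ℤ) : ZMod 4) = 0 := by push_cast; exact h
  rw [ZMod.intCast_zmod_eq_zero_iff_dvd] at this
  have h2 : (2 : ℤ) ∣ x ^ 2 := Dvd.dvd.trans (by norm_num) this
  exact even_iff_two_dvd.2 (Int.prime_two.dvd_of_dvd_pow h2)

/-- If `u^2 - y v^2 ∈ 4 ℤ[y]` with `u, v ∈ ℤ[y]`, then `u, v ∈ 2 ℤ[y]`. -/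
theorem even_of_normForm_dvd {n p₀ p₁ p₂ q₀ q₁ q₂ b c : ℤ} (hb : b = 3 * n + 4)
    (hc : c = 3 * n + 1)
    (h0 : 4 ∣ p₀ ^ 2 + 2 * p₁ * p₂ - b * p₂ ^ 2
      - ((q₁ ^ 2 + 2 * q₀ * q₂) - b * (2 * q₁ * q₂) + (b ^ 2 - c) * q₂ ^ 2))
    (h1 : 4 ∣ 2 * p₀ * p₁ - c * (2 * p₁ * p₂) + (b * c + 1) * p₂ ^ 2
      - (q₀ ^ 2 - c * (q₁ ^ 2 + 2 * q₀ * q₂) + (b * c + 1) * (2 * q₁ * q₂)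
        + (-b ^ 2 * c + c ^ 2 - b) * q₂ ^ 2))
    (h2 : 4 ∣ (p₁ ^ 2 + 2 * p₀ * p₂) - b * (2 * p₁ * p₂) + (b ^ 2 - c) * p₂ ^ 2
      - (2 * q₀ * q₁ - b * (q₁ ^ 2 + 2 * q₀ * q₂) + (b ^ 2 - c) * (2 * q₁ * q₂)
        + (-b ^ 3 + 2 * b * c + 1) * q₂ ^ 2)) :
    Even p₀ ∧ Even p₁ ∧ Even p₂ ∧ Even q₀ ∧ Even q₁ ∧ Even q₂ := by
  subst hb hc
  have e : ∀ z : ℤ, 4 ∣ z → (z : ZMod 4) = 0 := fun z hz =>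
    (ZMod.intCast_zmod_eq_zero_iff_dvd z 4).2 (by exact_mod_cast hz)
  replace h0 := e _ h0
  replace h1 := e _ h1
  replace h2 := e _ h2
  push_cast at h0 h1 h2
  -- The congruences now involve only squares, each 0 or 1 modulo 4, and n modulo 4: a finite check.
  simp only [zmod_four_mul_eq (p₀ : ZMod 4), zmod_four_mul_eq (p₁ : ZMod 4),
    zmod_four_mul_eq (q₀ : ZMod 4), zmod_four_mul_eq (q₁ : ZMod 4)] at h0 h1 h2
  suffices H : (p₀ : ZMod 4) ^ 2 = 0 ∧ (p₁ : ZMod 4) ^ 2 = 0 ∧ (p₂ : ZMod 4) ^ 2 = 0 ∧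
      (q₀ : ZMod 4) ^ 2 = 0 ∧ (q₁ : ZMod 4) ^ 2 = 0 ∧ (q₂ : ZMod 4) ^ 2 = 0 from
    ⟨even_of_zmod_four_sq_eq_zero H.1, even_of_zmod_four_sq_eq_zero H.2.1,
      even_of_zmod_four_sq_eq_zero H.2.2.1, even_of_zmod_four_sq_eq_zero H.2.2.2.1,
      even_of_zmod_four_sq_eq_zero H.2.2.2.2.1, even_of_zmod_four_sq_eq_zero H.2.2.2.2.2⟩
  generalize (n : ZMod 4) = n at *
  rcases zmod_four_sq_eq (p₀ : ZMod 4) with a0 | a0 <;>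
  rcases zmod_four_sq_eq (p₁ : ZMod 4) with a1 | a1 <;>
  rcases zmod_four_sq_eq (p₂ : ZMod 4) with a2 | a2 <;>
  rcases zmod_four_sq_eq (q₀ : ZMod 4) with a3 | a3 <;>
  rcases zmod_four_sq_eq (q₁ : ZMod 4) with a4 | a4 <;>
  rcases zmod_four_sq_eq (q₂ : ZMod 4) with a5 | a5 <;>
  simp only [a0, a1, a2, a3, a4, a5] at h0 h1 h2 ⊢ <;>
  clear a0 a1 a2 a3 a4 a5 <;>
  (revert n; decide)

theorem aeval_sq_resolventCubic {n : ℤ} {θ : ℂ} (hθ : aeval θ (evenSextic n) = 0) :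
    aeval (θ ^ 2) (resolventCubic n) = 0 := by
  rw [aeval_evenSextic] at hθ
  rw [aeval_resolventCubic]
  linear_combination hθ

theorem isIntegral_of_evenSextic {n : ℤ} {θ : ℂ} (hθ : aeval θ (evenSextic n) = 0) :
    IsIntegral ℤ θ := ⟨_, evenSextic_monic n, hθ⟩

/-- If `D_n` is squarefree, then `1, θ, …, θ^5` is an integral basis of the sextic field `ℚ(θ)`. -/
theorem exists_eq_intCast_of_isIntegral_sextic {n : ℤ} {θ : ℂ} (hD : Squarefree (sexticD n))
    (hθ : aeval θ (evenSextic n) = 0) {A B C A' B' C' : ℚ}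
    (h : IsIntegral ℤ (A + B * θ ^ 2 + C * (θ ^ 2) ^ 2 +
      θ * (A' + B' * θ ^ 2 + C' * (θ ^ 2) ^ 2) : ℂ)) :
    (∃ m : ℤ, A = m) ∧ (∃ m : ℤ, B = m) ∧ (∃ m : ℤ, C = m) ∧
    (∃ m : ℤ, A' = m) ∧ (∃ m : ℤ, B' = m) ∧ (∃ m : ℤ, C' = m) := by
  have hθ' : aeval (-θ) (evenSextic n) = 0 := by
    rw [aeval_evenSextic] at hθ ⊢; linear_combination hθ
  have hy := aeval_sq_resolventCubic hθ
  have iθ := isIntegral_of_evenSextic hθ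
  have iint := isIntegral_intCast_complex
  have h' : IsIntegral ℤ (A + B * θ ^ 2 + C * (θ ^ 2) ^ 2 -
      θ * (A' + B' * θ ^ 2 + C' * (θ ^ 2) ^ 2) : ℂ) := by
    have e : ∀ t : ℂ, aeval t (Polynomial.C A + Polynomial.C B * X ^ 2 +
        Polynomial.C C * (X ^ 2) ^ 2 + X * (Polynomial.C A' + Polynomial.C B' * X ^ 2 +
        Polynomial.C C' * (X ^ 2) ^ 2)) = (A + B * t ^ 2 + C * (t ^ 2) ^ 2 +
          t * (A' + B' * t ^ 2 + C' * (t ^ 2) ^ 2) : ℂ) := fun t => by simp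
    have hmin : aeval (-θ) (minpoly ℚ θ) = 0 := by
      rw [minpoly_rat_eq_overRat (evenSextic_monic n) (evenSextic_irreducible n) hθ,
        aeval_overRat, hθ']
    rw [← e] at h
    have := isIntegral_aeval_of_conj hmin _ h
    rw [e] at this
    refine (congrArg (IsIntegral ℤ) ?_).mpr (this)
    ring
  rw [aeval_evenSextic] at hθ
  obtain ⟨y, hyθ⟩ : ∃ y, y = θ ^ 2 := ⟨_, rfl⟩
  rw [← hyθ] at h h' hy
  obtain ⟨p₀, p₁, p₂, hp₀, hp₁, hp₂⟩ := exists_eq_intCast_of_isIntegral_cubic hD hy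
    (A := 2 * A) (B := 2 * B) (C := 2 * C) (by
      refine (congrArg (IsIntegral ℤ) ?_).mpr (h.add h'); push_cast; ring)
  obtain ⟨q₀, q₁, q₂, hq₀, hq₁, hq₂⟩ := exists_eq_intCast_of_isIntegral_cubic hD hy
    (A := 2 * A') (B := 2 * B') (C := 2 * C') (by
      -- This integral element is θ⁻¹; multiplying the difference 2θv by it gives 2v.
      have iv : IsIntegral ℤ (θ ^ 5 + ((3 * n + 4 : ℤ) : ℂ) * θ ^ 3 + ((3 * n + 1 : ℤ) : ℂ) * θ) :=
        ((iθ.pow 5).add ((iint _).mul (iθ.pow 3))).add ((iint _).mul iθ)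
      refine (congrArg (IsIntegral ℤ) ?_).mpr ((h.sub h').mul iv)
      push_cast
      linear_combination (-2 * (A' + B' * y + C' * y ^ 2 : ℂ)) * hθ)
  have hN := (h.mul h')
  rw [aeval_resolventCubic] at hy
  obtain ⟨b, hb⟩ : ∃ b : ℤ, b = 3 * n + 4 := ⟨_, rfl⟩
  obtain ⟨c, hc⟩ : ∃ c : ℤ, c = 3 * n + 1 := ⟨_, rfl⟩
  have hbC : (b : ℂ) = 3 * n + 4 := by rw [hb]; push_cast; ring
  have hcC : (c : ℂ) = 3 * n + 1 := by rw [hc]; push_cast; ring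
  rw [← hbC, ← hcC] at hy
  -- A, B, C are the coefficients of u² - yv² = (p² - yq²)/4 after reduction by y³ = -by² - cy + 1.
  obtain ⟨e₀, e₁, e₂, he₀, he₁, he₂⟩ := exists_eq_intCast_of_isIntegral_cubic hD
    (aeval_sq_resolventCubic (θ := θ) (by rw [aeval_evenSextic, hθ]))
    (A := (p₀ ^ 2 + 2 * p₁ * p₂ - b * p₂ ^ 2
      - ((q₁ ^ 2 + 2 * q₀ * q₂) - b * (2 * q₁ * q₂) + (b ^ 2 - c) * q₂ ^ 2)) / 4)
    (B := (2 * p₀ * p₁ - c * (2 * p₁ * p₂) + (b * c + 1) * p₂ ^ 2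
      - (q₀ ^ 2 - c * (q₁ ^ 2 + 2 * q₀ * q₂) + (b * c + 1) * (2 * q₁ * q₂)
        + (-b ^ 2 * c + c ^ 2 - b) * q₂ ^ 2)) / 4)
    (C := ((p₁ ^ 2 + 2 * p₀ * p₂) - b * (2 * p₁ * p₂) + (b ^ 2 - c) * p₂ ^ 2
      - (2 * q₀ * q₁ - b * (q₁ ^ 2 + 2 * q₀ * q₂) + (b ^ 2 - c) * (2 * q₁ * q₂)
        + (-b ^ 3 + 2 * b * c + 1) * q₂ ^ 2)) / 4) (by
      rw [← hyθ]
      refine (congrArg (IsIntegral ℤ) ?_).mpr (hN)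
      have cast2 : ∀ {q : ℚ} {p : ℤ}, 2 * q = p → (q : ℂ) = p / 2 := fun {q p} h => by
        have : q = p / 2 := by linarith
        rw [this]; push_cast; rfl
      rw [cast2 hp₀, cast2 hp₁, cast2 hp₂, cast2 hq₀, cast2 hq₁, cast2 hq₂]
      have hsq : θ * θ = y := by rw [hyθ]; ring
      push_cast
      linear_combination (1 / 4 : ℂ) * (q₀ + q₁ * y + q₂ * y ^ 2) ^ 2 * hsq + (-(2*p₁*p₂ + p₂^2*(y-b)) + ((q₁^2+2*q₀*q₂) + 2*q₁*q₂*(y-b) + q₂^2*(y^2-b*y+(b^2-c)))) / 4 * hy)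
  have d4 : ∀ {x e : ℤ}, (x / 4 : ℚ) = e → 4 ∣ x := fun {x e} h => ⟨e, by
    have : (x : ℚ) = 4 * e := by linarith
    exact_mod_cast this⟩
  obtain ⟨⟨r₀, k₀⟩, ⟨r₁, k₁⟩, ⟨r₂, k₂⟩, ⟨s₀, l₀⟩, ⟨s₁, l₁⟩, ⟨s₂, l₂⟩⟩ :=
    even_of_normForm_dvd hb hc (d4 (by push_cast; exact he₀)) (d4 (by push_cast; exact he₁))
      (d4 (by push_cast; exact he₂))
  have fin : ∀ {q : ℚ} {p r : ℤ}, 2 * q = p → p = r + r → ∃ m : ℤ, q = m := fun {q p r} h h' =>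
    ⟨r, by rw [h'] at h; push_cast at h; linarith⟩
  exact ⟨fin hp₀ k₀, fin hp₁ k₁, fin hp₂ k₂, fin hq₀ l₀, fin hq₁ l₁, fin hq₂ l₂⟩

theorem isMonogenicPoly_evenSextic_of_squarefree {n : ℤ} (hD : Squarefree (sexticD n)) :
    IsMonogenicPoly (evenSextic n) := by
  rw [isMonogenicPoly_iff]
  refine ⟨evenSextic_monic n, evenSextic_irreducible n, fun θ hθ => ?_⟩
  rw [evenSextic_natDegree]
  intro c hc
  simp only [Fin.sum_univ_six] at hc
  obtain ⟨h0, h2, h4, h1, h3, h5⟩ := exists_eq_intCast_of_isIntegral_sextic hD hθ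
    (A := c 0) (B := c 2) (C := c 4) (A' := c 1) (B' := c 3) (C' := c 5) (by
      refine (congrArg (IsIntegral ℤ) ?_).mpr hc
      simp
      ring)
  intro i
  fin_cases i
  exacts [h0, h1, h2, h3, h4, h5]

theorem squarefree_of_isMonogenicPoly_evenSextic {n : ℤ} (h : IsMonogenicPoly (evenSextic n)) :
    Squarefree (sexticD n) := by
  intro x hx
  obtain ⟨hm, hi, H⟩ := (isMonogenicPoly_iff _).1 h
  obtain ⟨k, hk⟩ := hx
  have hx0 : x ≠ 0 := by
    rintro rfl
    have := (sexticD_pos n).ne'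
    simp at hk; exact this hk
  have hxC : (x : ℂ) ≠ 0 := by exact_mod_cast hx0
  obtain ⟨θ, hθ⟩ : ∃ θ : ℂ, aeval θ (evenSextic n) = 0 := by
    obtain ⟨θ, hθ⟩ := IsAlgClosed.exists_aeval_eq_zero ℂ (overRat (evenSextic n)) (by
      rw [(evenSextic_monic n).degree_map, degree_eq_natDegree (evenSextic_monic n).ne_zero,
        evenSextic_natDegree]
      norm_num)
    exact ⟨θ, by rwa [aeval_overRat] at hθ⟩
  have hz3 := traceZero_cube (aeval_sq_resolventCubic hθ)
  set z : ℂ := 3 * θ ^ 2 + (3 * n + 4) with hz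
  have hint : IsIntegral ℤ (z ^ 2 / x) := by
    -- Squaring z(z² - 3D) = -D(6n+5) gives a cubic for z²; substitute D = x²k and divide by x³.
    refine ⟨X ^ 3 + C (-6 * (x * k)) * X ^ 2 + C (9 * x ^ 2 * k ^ 2) * X
      + C (-(x * k ^ 2 * (6 * n + 5) ^ 2)), by monicity!, ?_⟩
    rw [← aeval_def]
    simp only [map_add, map_mul, map_pow, aeval_X, aeval_C]
    have hk' : ((sexticD n : ℤ) : ℂ) = x * x * k := by rw [hk]; push_cast; ring
    rw [hk'] at hz3
    simp
    field_simp
    linear_combination (z ^ 3 - 3 * x * x * k * z - x * x * k * (6 * n + 5)) * hz3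
  rw [evenSextic_natDegree] at H
  -- Coordinates of z²/x in powers of θ; the entry at index 4 is 9/x.
  obtain ⟨m, hm'⟩ := H θ hθ ![(3 * n + 4) ^ 2 / x, 0, 6 * (3 * n + 4) / x, 0, 9 / x, 0] (by
    refine (congrArg (IsIntegral ℤ) ?_).mpr hint
    simp [Fin.sum_univ_six]
    rw [hz]
    field_simp
    ring) 4
  have hxQ : (x : ℚ) ≠ 0 := by exact_mod_cast hx0
  have h9 : x ∣ 9 := ⟨m, by
    have : (9 : ℚ) / x = m := by simpa using hm'
    rw [div_eq_iff hxQ] at this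
    have : ((9 : ℤ) : ℚ) = (x * m : ℤ) := by push_cast; linarith
    exact_mod_cast this⟩
  have hcop : IsCoprime (sexticD n) (3 ^ 2) := (sexticD_coprime_three n).pow_right
  exact hcop.isUnit_of_dvd' (hk ▸ (dvd_mul_right x x).mul_right k) (by norm_num; exact h9)

theorem isMonogenicPoly_evenSextic_iff (n : ℤ) :
    IsMonogenicPoly (evenSextic n) ↔ Squarefree (sexticD n) :=
  ⟨squarefree_of_isMonogenicPoly_evenSextic, isMonogenicPoly_evenSextic_of_squarefree⟩

/-! ### The field determines D_n -/

/-- If two roots `t`, `s` of integer polynomials generate the same ring `ℤ[t] = ℤ[s]`, then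
`f'(t)` divides `g'(s)` in that ring. -/
theorem derivative_dvd_of_adjoin_eq {f g P Q : ℤ[X]} (hm : f.Monic) (hi : Irreducible f) {t s : ℂ}
    (ht : aeval t f = 0) (hs : aeval s g = 0) (hP : s = aeval t P) (hQ : t = aeval s Q) :
    ∃ R : ℤ[X], aeval s (derivative g) = aeval t (derivative f) * aeval t R := by
  have hdvd : ∀ p : ℤ[X], aeval t p = 0 → f ∣ p := fun p hp => by
    have := minpoly.isIntegrallyClosed_dvd (R := ℤ) (s := t) ⟨f, hm, ht⟩ hp
    rwa [minpoly_int_eq hm hi ht] at this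
  obtain ⟨R, hR⟩ := hdvd (g.comp P) (by rw [aeval_comp, ← hP, hs])
  obtain ⟨S, hS⟩ := hdvd (X - Q.comp P) (by
    rw [map_sub, aeval_comp, ← hP, ← hQ, aeval_X, sub_self])
  -- Differentiating at t gives g'(s)P'(t) = f'(t)R(t) and 1 - Q'(s)P'(t) = f'(t)S(t); eliminate
  -- P'(t).
  have hR' := congrArg (fun p => aeval t (derivative p)) hR
  have hS' := congrArg (fun p => aeval t (derivative p)) hS
  simp only [derivative_comp, derivative_mul, derivative_X, map_mul, map_add,
    map_sub, map_one, aeval_comp, ← hP, ht, zero_mul, add_zero] at hR' hS'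
  refine ⟨R * (derivative Q).comp P + S * (derivative g).comp P, ?_⟩
  simp only [map_add, map_mul, aeval_comp, ← hP]
  linear_combination aeval s (derivative Q) * hR' + aeval s (derivative g) * hS'

theorem aeval_isIntegral {t : ℂ} (h : IsIntegral ℤ t) (P : ℤ[X]) : IsIntegral ℤ (aeval t P) :=
  IsIntegral.of_mem_of_fg _ h.fg_adjoin_singleton _ (aeval_mem_adjoin_singleton ℤ t)

/-- Up to the unit `θ^5 (1 + θ^2)`, the cube of `f_n'(θ)` is `8 D_n^2`. -/
theorem derivative_evenSextic_cube {n : ℤ} {θ : ℂ} (hθ : aeval θ (evenSextic n) = 0) :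
    aeval θ (derivative (evenSextic n)) ^ 3 = 8 * ((sexticD n : ℤ) : ℂ) ^ 2 * (θ ^ 5 * (1 + θ ^ 2))
    ∧ IsIntegral ℤ (θ ^ 5 * (1 + θ ^ 2)) ∧ IsIntegral ℤ (θ ^ 5 * (1 + θ ^ 2))⁻¹ := by
  have iθ := isIntegral_of_evenSextic hθ
  have hy := aeval_sq_resolventCubic hθ
  rw [aeval_resolventCubic] at hy
  refine ⟨?_, (iθ.pow 5).mul (isIntegral_one.add (iθ.pow 2)), ?_⟩
  · have : aeval θ (derivative (evenSextic n)) =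
        2 * θ * (3 * (θ ^ 2) ^ 2 + 2 * (3 * n + 4) * θ ^ 2 + (3 * n + 1)) := by
      simp [evenSextic, map_ofNat]
      ring
    rw [this]
    have h1 : (3 * (θ ^ 2) ^ 2 + 2 * (3 * n + 4) * θ ^ 2 + (3 * n + 1)) ^ 3 =
        ((sexticD n : ℤ) : ℂ) ^ 2 * (θ ^ 2 + (θ ^ 2) ^ 2) := by
      generalize θ ^ 2 = y at *
      unfold sexticD
      push_cast
      linear_combination ((-1 + -9*n + -27*n^2 + -27*n^3) + (144 + 216*n + 81*n^2)*y +
        (108 + 81*n)*y^2 + (27)*y^3 : ℂ) * hy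
    linear_combination 8 * θ ^ 3 * h1
  -- Explicit inverse: θ⁻¹ = θ⁵ + (3n+4)θ³ + (3n+1)θ, and (1+y)⁻¹ is minus the conjugate -1/(1+y).
  · have e : (θ ^ 5 * (1 + θ ^ 2)) *
        (aeval θ ((-(X ^ 4 + C (3 * n + 3) * X ^ 2 - 2)) *
          (X ^ 5 + C (3 * n + 4) * X ^ 3 + C (3 * n + 1) * X) ^ 5 : ℤ[X])) = 1 := by
      have h1 : θ * (θ ^ 5 + (3 * n + 4) * θ ^ 3 + (3 * n + 1) * θ) = 1 := by
        linear_combination hy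
      have h2 : (1 + θ ^ 2) * -(θ ^ 4 + (3 * n + 3) * θ ^ 2 - 2) = 1 := by
        linear_combination -hy
      simp [map_ofNat]
      calc _ = (θ * (θ ^ 5 + (3 * n + 4) * θ ^ 3 + (3 * n + 1) * θ)) ^ 5 *
            ((1 + θ ^ 2) * -(θ ^ 4 + (3 * n + 3) * θ ^ 2 - 2)) := by ring
        _ = 1 := by rw [h1, h2]; norm_num
    rw [inv_eq_of_mul_eq_one_right e]
    exact aeval_isIntegral iθ _

/-- Cubing f_n'(t) ∣ f_m'(s) makes the rational number D_m²/D_n² a product of algebraic integers,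
hence an integer. -/
theorem sexticD_sq_dvd_of_adjoin_eq {n m : ℤ} {P Q : ℤ[X]} {t s : ℂ}
    (ht : aeval t (evenSextic n) = 0) (hs : aeval s (evenSextic m) = 0)
    (hP : s = aeval t P) (hQ : t = aeval s Q) : sexticD n ^ 2 ∣ sexticD m ^ 2 := by
  obtain ⟨R, hR⟩ := derivative_dvd_of_adjoin_eq (evenSextic_monic n) (evenSextic_irreducible n)
    ht hs hP hQ
  obtain ⟨h1, i1, -⟩ := derivative_evenSextic_cube ht
  obtain ⟨h2, -, i2⟩ := derivative_evenSextic_cube hs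
  have iR := aeval_isIntegral (isIntegral_of_evenSextic ht) R
  have hs0 : s ^ 5 * (1 + s ^ 2) ≠ 0 := by
    intro h0
    rw [aeval_evenSextic] at hs
    rcases mul_eq_zero.1 h0 with h | h
    · rw [pow_eq_zero_iff (by norm_num)] at h
      rw [h] at hs; norm_num at hs
    · have h3 : s ^ 2 = -1 := by linear_combination h
      have : (1 : ℂ) = 0 := by
        linear_combination hs - (s ^ 4 + (3 * m + 3) * s ^ 2 - 2) * h
      exact one_ne_zero this
  have hD := sexticD_ne_zero_complex n
  rw [hR, mul_pow, h1] at h2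
  have hq : ((sexticD m ^ 2 / sexticD n ^ 2 : ℚ) : ℂ) =
      (t ^ 5 * (1 + t ^ 2)) * aeval t R ^ 3 * (s ^ 5 * (1 + s ^ 2))⁻¹ := by
    push_cast
    rw [← div_eq_mul_inv, div_eq_div_iff (pow_ne_zero 2 hD) hs0]
    linear_combination (-1 / 8 : ℂ) * h2
  obtain ⟨k, hk⟩ := exists_intCast_of_isIntegral (by
    rw [hq]; exact (i1.mul (iR.pow 3)).mul i2)
  have hDq : (sexticD n : ℚ) ^ 2 ≠ 0 := pow_ne_zero 2 (by exact_mod_cast (sexticD_pos n).ne')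
  rw [div_eq_iff hDq] at hk
  refine ⟨k, ?_⟩
  have : ((sexticD m ^ 2 : ℤ) : ℚ) = (sexticD n ^ 2 * k : ℤ) := by push_cast; linarith
  exact_mod_cast this

theorem sexticD_injective : Function.Injective sexticD := by
  intro n m h
  unfold sexticD at h
  have : (n - m) * (3 * (3 * (n + m) + 5)) = 0 := by linear_combination h
  rcases mul_eq_zero.1 this with h | h <;> omega

/-- An integral element of `ℚ(θ)`, for a root `θ` of a monogenic polynomial, lies in `ℤ[θ]`. -/
theorem IsMonogenicPoly.exists_eq_aeval {f : ℤ[X]} (hf : IsMonogenicPoly f) {θ : ℂ}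
    (hθ : aeval θ f = 0) {x : ℂ} (hx : x ∈ ℚ⟮θ⟯) (hi : IsIntegral ℤ x) :
    ∃ P : ℤ[X], x = aeval θ P := by
  obtain ⟨hm, hirr, H⟩ := (isMonogenicPoly_iff f).1 hf
  obtain ⟨c, rfl⟩ := exists_eq_sum_pow_of_mem_adjoin hm hirr hθ hx
  choose g hg using H θ hθ c hi
  exact ⟨∑ i, C (g i) * X ^ (i : ℕ), by simp [hg]⟩

/-- Both power bases generate maximal orders, so a field isomorphism matches ℤ[θ] with ℤ[η], and the
divisibility of D² holds in both directions. -/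
theorem eq_of_generateSameField {n m : ℤ} (hn : Squarefree (sexticD n))
    (hm : Squarefree (sexticD m)) (h : GenerateSameField (evenSextic n) (evenSextic m)) :
    n = m := by
  obtain ⟨θ, η, hθ, hη, ⟨φ⟩⟩ := h
  have coe_aeval : ∀ (α : ℂ) (x : ℚ⟮α⟯) (P : ℤ[X]), ((aeval x P : ℚ⟮α⟯) : ℂ) = aeval (x : ℂ) P :=
    fun α x P => (aeval_algebraMap_apply ℂ x P).symm
  have map_aeval : ∀ {α β : ℂ} (ψ : ℚ⟮α⟯ ≃ₐ[ℚ] ℚ⟮β⟯) (x : ℚ⟮α⟯) (P : ℤ[X]),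
      ψ (aeval x P) = aeval (ψ x) P := fun ψ x P =>
    (aeval_algHom_apply (ψ.toAlgHom.restrictScalars ℤ) x P).symm
  let tθ : ℚ⟮θ⟯ := ⟨θ, mem_adjoin_simple_self ℚ θ⟩
  let tη : ℚ⟮η⟯ := ⟨η, mem_adjoin_simple_self ℚ η⟩
  have hs : aeval ((φ.symm tη : ℚ⟮θ⟯) : ℂ) (evenSextic m) = 0 := by
    rw [← coe_aeval, ← map_aeval]
    have : aeval tη (evenSextic m) = 0 := Subtype.ext (by rw [coe_aeval]; exact hη)
    rw [this, map_zero]; rfl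
  have hs' : aeval ((φ tθ : ℚ⟮η⟯) : ℂ) (evenSextic n) = 0 := by
    rw [← coe_aeval, ← map_aeval]
    have : aeval tθ (evenSextic n) = 0 := Subtype.ext (by rw [coe_aeval]; exact hθ)
    rw [this, map_zero]; rfl
  obtain ⟨P, hP⟩ := (isMonogenicPoly_evenSextic_of_squarefree hn).exists_eq_aeval hθ
    (φ.symm tη).2 (isIntegral_of_evenSextic hs)
  obtain ⟨Q, hQ⟩ := (isMonogenicPoly_evenSextic_of_squarefree hm).exists_eq_aeval hη
    (φ tθ).2 (isIntegral_of_evenSextic hs')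
  have hQ' : θ = aeval ((φ.symm tη : ℚ⟮θ⟯) : ℂ) Q := by
    have h1 : φ tθ = aeval tη Q := Subtype.ext (by rw [coe_aeval]; exact hQ)
    have h2 : tθ = aeval (φ.symm tη) Q := by rw [← map_aeval, ← h1, φ.symm_apply_apply]
    rw [← coe_aeval, ← h2]
  have d1 := sexticD_sq_dvd_of_adjoin_eq hθ hs hP hQ'
  have d2 := sexticD_sq_dvd_of_adjoin_eq hs hθ hQ' hP
  have := Int.dvd_antisymm (sq_nonneg _) (sq_nonneg _) d1 d2
  exact sexticD_injective ((sq_eq_sq₀ (sexticD_pos n).le (sexticD_pos m).le).1 this)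

/-! ### Infinitely many squarefree values of D_n -/

/-- D_n = 9(u² + u + 1) with u = n + 1/3, so u is an element of order 3 modulo p; moreover D_n is
odd. -/
theorem prime_mod_six_of_dvd_sexticD {p : ℕ} (hp : p.Prime) {n : ℤ} (h : (p : ℤ) ∣ sexticD n) :
    p % 6 = 1 := by
  have hodd : ¬ (2 : ℤ) ∣ sexticD n := by
    unfold sexticD
    rcases Int.even_or_odd' n with ⟨k, rfl | rfl⟩ <;> ring_nf <;> omega
  have h3 : ¬ (3 : ℤ) ∣ sexticD n := by unfold sexticD; omega
  have hp2 : p ≠ 2 := by rintro rfl; exact hodd h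
  have hp3 : p ≠ 3 := by rintro rfl; exact h3 h
  have hmod2 : p % 2 = 1 := hp.eq_two_or_odd.resolve_left hp2
  have := Fact.mk hp
  have hz : (9 * (n : ZMod p) ^ 2 + 15 * n + 13) = 0 := by
    have := (ZMod.intCast_zmod_eq_zero_iff_dvd (sexticD n) p).2 h
    unfold sexticD at this; push_cast at this; exact this
  have h3z : (3 : ZMod p) ≠ 0 := by
    intro h0
    have : ((3 : ℕ) : ZMod p) = 0 := by exact_mod_cast h0
    rw [ZMod.natCast_eq_zero_iff] at this
    exact hp3 ((Nat.prime_dvd_prime_iff_eq hp Nat.prime_three).1 this)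
  have horder : 3 ∣ p - 1 := by
    obtain ⟨c, hc⟩ : ∃ c : ZMod p, 3 * c = 1 := ⟨3⁻¹, mul_inv_cancel₀ h3z⟩
    obtain ⟨u, hu⟩ : ∃ u : ZMod p, u ^ 2 + u + 1 = 0 := by
      refine ⟨n + c, ?_⟩
      have : (3 * 3) * (((n : ZMod p) + c) ^ 2 + (n + c) + 1) = 0 := by
        linear_combination hz + (6 * n + 3 * c + 4) * hc
      exact (mul_eq_zero.1 this).resolve_left (mul_ne_zero h3z h3z)
    have hu3 : u ^ 3 = 1 := by linear_combination (u - 1) * hu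
    have hu1 : u ≠ 1 := by
      intro h1
      rw [h1] at hu
      exact h3z (by linear_combination hu)
    have hu0 : u ≠ 0 := by
      intro h1
      rw [h1] at hu
      norm_num at hu
    rw [← orderOf_eq_prime hu3 hu1]
    exact orderOf_dvd_of_pow_eq_one (ZMod.pow_card_sub_one_eq_one hu0)
  have := hp.two_le
  omega

/-- The solutions of `D_n ≡ 0 (mod p^2)` lie in at most two residue classes. -/
theorem sexticD_sq_dvd_residues {p : ℕ} (hp : p.Prime) {m n : ℤ} (hm : (p : ℤ) ^ 2 ∣ sexticD m)
    (hn : (p : ℤ) ^ 2 ∣ sexticD n) :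
    (p : ℤ) ^ 2 ∣ n - m ∨ (p : ℤ) ^ 2 ∣ 3 * (n + m) + 5 := by
  have hpp : Prime (p : ℤ) := Nat.prime_iff_prime_int.1 hp
  have hp1 : (p : ℤ) ∣ sexticD m := Dvd.dvd.trans (dvd_pow_self _ two_ne_zero) hm
  have hcop3 : IsCoprime (p : ℤ) 3 := (sexticD_coprime_three m).of_isCoprime_of_dvd_left hp1
  have hcop := (sexticD_coprime_linear m).of_isCoprime_of_dvd_left hp1
  have hprod : (p : ℤ) ^ 2 ∣ (n - m) * (3 * (n + m) + 5) := by
    have : (p : ℤ) ^ 2 ∣ 3 * ((n - m) * (3 * (n + m) + 5)) := by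
      have e : 3 * ((n - m) * (3 * (n + m) + 5)) = sexticD n - sexticD m := by
        unfold sexticD; ring
      rw [e]; exact dvd_sub hn hm
    exact (hcop3.pow_left).dvd_of_dvd_mul_left this
  by_cases h1 : (p : ℤ) ∣ n - m
  · left
    -- A prime dividing both factors would divide 6m+5, which is coprime to D_m.
    have h2 : IsCoprime (p : ℤ) (3 * (n + m) + 5) := by
      refine (Prime.coprime_iff_not_dvd hpp).2 fun h2 => ?_
      have : (p : ℤ) ∣ 6 * m + 5 := by
        have e : 6 * m + 5 = (3 * (n + m) + 5) - 3 * (n - m) := by ring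
        rw [e]; exact dvd_sub h2 (h1.mul_left 3)
      exact hpp.not_isUnit (hcop.isUnit_of_dvd' dvd_rfl (this.trans (dvd_pow_self _ two_ne_zero)))
    exact (h2.pow_left).dvd_of_dvd_mul_right hprod
  · right
    exact (((Prime.coprime_iff_not_dvd hpp).2 h1).pow_left).dvd_of_dvd_mul_left hprod

theorem card_filter_modEq_le (a b v : ℤ) {r : ℤ} (hr : 0 < r) (hab : a ≤ b) :
    (({x ∈ Finset.Ioc a b | x ≡ v [ZMOD r]}.card : ℕ) : ℚ) ≤ (b - a) / r + 1 := by
  have h := Int.Ioc_filter_modEq_card a b hr v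
  have h' : ((({x ∈ Finset.Ioc a b | x ≡ v [ZMOD r]}.card : ℕ) : ℤ) : ℚ) ≤ (b - a) / r + 1 := by
    rw [h]
    have hr' : (0 : ℚ) < r := by exact_mod_cast hr
    have hab' : (a : ℚ) ≤ b := by exact_mod_cast hab
    push_cast
    refine max_le ?_ (by have := div_nonneg (sub_nonneg.2 hab') hr'.le; linarith)
    have h1 := Int.floor_le (((b : ℚ) - v) / r)
    have h2 := Int.lt_floor_add_one (((a : ℚ) - v) / r)
    have h3 : ((b : ℚ) - v) / r - (a - v) / r = (b - a) / r := by ring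
    linarith
  exact_mod_cast h'

theorem card_filter_sq_dvd_sexticD_le {p : ℕ} (hp : p.Prime) {a b : ℤ} (hab : a ≤ b) :
    (({n ∈ Finset.Ioc a b | (p : ℤ) ^ 2 ∣ sexticD n}.card : ℕ) : ℚ) ≤
      2 * ((b - a) / (p : ℚ) ^ 2 + 1) := by
  have hr : (0 : ℤ) < (p : ℤ) ^ 2 := by have := hp.pos; positivity
  have hab' : (a : ℚ) ≤ b := by exact_mod_cast hab
  rcases Finset.eq_empty_or_nonempty {n ∈ Finset.Ioc a b | (p : ℤ) ^ 2 ∣ sexticD n} with h | h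
  · rw [h]
    have : (0 : ℚ) ≤ (b - a) / (p : ℚ) ^ 2 := div_nonneg (sub_nonneg.2 hab') (by positivity)
    rw [Finset.card_empty, Nat.cast_zero]
    linarith
  · obtain ⟨m, hm⟩ := h
    have hm' := (Finset.mem_filter.1 hm).2
    have hp1 : (p : ℤ) ∣ sexticD m := Dvd.dvd.trans (dvd_pow_self _ two_ne_zero) hm'
    have hcop3 : IsCoprime ((p : ℤ) ^ 2) 3 :=
      ((sexticD_coprime_three m).of_isCoprime_of_dvd_left hp1).pow_left
    obtain ⟨u, v, huv⟩ := hcop3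
    have hsub : {n ∈ Finset.Ioc a b | (p : ℤ) ^ 2 ∣ sexticD n} ⊆
        {x ∈ Finset.Ioc a b | x ≡ m [ZMOD (p : ℤ) ^ 2]} ∪
        -- Here v is the inverse of 3 modulo p², so this class solves 3(n+m) + 5 ≡ 0.
        {x ∈ Finset.Ioc a b | x ≡ -m - 5 * v [ZMOD (p : ℤ) ^ 2]} := by
      intro n hn
      obtain ⟨hn1, hn2⟩ := Finset.mem_filter.1 hn
      rw [Finset.mem_union, Finset.mem_filter, Finset.mem_filter]
      rcases sexticD_sq_dvd_residues hp hm' hn2 with h | h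
      · exact Or.inl ⟨hn1, (Int.modEq_iff_dvd.2 h).symm⟩
      · refine Or.inr ⟨hn1, (Int.modEq_iff_dvd.2 ?_).symm⟩
        have : n - (-m - 5 * v) = v * (3 * (n + m) + 5) + (p : ℤ) ^ 2 * (u * (n + m)) := by
          linear_combination (-(n + m)) * huv
        rw [this]
        exact dvd_add (h.mul_left _) (dvd_mul_right _ _)
    have h1 := card_filter_modEq_le a b m hr hab
    have h2 := card_filter_modEq_le a b (-m - 5 * v) hr hab
    have h3 := (Finset.card_le_card hsub).trans (Finset.card_union_le _ _)
    rw [← Nat.cast_le (α := ℚ)] at h3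
    push_cast at h1 h2 h3
    linarith

/-- Telescoping, from (6k+7)² ≥ (6k+4)(6k+10). -/
theorem sum_inv_sq_le (M : ℕ) :
    ∑ k ∈ Finset.range M, (1 / (6 * (k : ℚ) + 7) ^ 2) ≤ 1 / 24 - 1 / (6 * (6 * (M : ℚ) + 4)) := by
  induction M with
  | zero => norm_num
  | succ M ih =>
    rw [Finset.sum_range_succ]
    have h : 1 / (6 * (M : ℚ) + 7) ^ 2 ≤ 1 / ((6 * M + 4) * (6 * M + 10)) :=
      one_div_le_one_div_of_le (by positivity) (by nlinarith)
    have e : 1 / ((6 * (M : ℚ) + 4) * (6 * M + 10)) =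
        1 / (6 * (6 * M + 4)) - 1 / (6 * (6 * ((M + 1 : ℕ) : ℚ) + 4)) := by
      push_cast
      field_simp
      ring
    linarith

theorem exists_prime_sq_dvd_sexticD {n : ℤ} {M : ℕ} (hn : n ∈ Finset.Ioc (-(2 * M : ℤ)) (2 * M))
    (h : ¬ Squarefree (sexticD n)) :
    ∃ k < M, (6 * k + 7).Prime ∧ (((6 * k + 7 : ℕ) : ℤ)) ^ 2 ∣ sexticD n := by
  rw [← Int.squarefree_natAbs, Nat.squarefree_iff_prime_squarefree] at h
  push Not at h
  obtain ⟨p, hp, hd⟩ := h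
  have hd' : (p : ℤ) ^ 2 ∣ sexticD n := by
    rw [← Int.dvd_natAbs, sq]; exact_mod_cast hd
  have hmod := prime_mod_six_of_dvd_sexticD hp (Dvd.dvd.trans (dvd_pow_self _ two_ne_zero) hd')
  have hle := Int.le_of_dvd (sexticD_pos n) hd'
  rw [Finset.mem_Ioc] at hn
  -- This gives p ≤ 6M+4, and p ≡ 1 modulo 6 then leaves p = 6k+7 with k < M.
  have hb : sexticD n ≤ (6 * (M : ℤ) + 4) ^ 2 := by
    unfold sexticD; nlinarith
  have hpM : (p : ℤ) ≤ 6 * M + 4 := by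
    by_contra hlt
    push Not at hlt
    nlinarith [hle.trans hb]
  have hp2 := hp.two_le
  obtain ⟨k, rfl⟩ : ∃ k, p = 6 * k + 7 := ⟨(p - 7) / 6, by omega⟩
  exact ⟨k, by omega, hp, hd'⟩

theorem infinite_squarefree_sexticD : {n : ℤ | Squarefree (sexticD n)}.Infinite := by
  intro hfin
  set S := hfin.toFinset with hS
  -- Of the 4M integers in the window, at most 8M/24 + 2M are not squarefree values, leaving at
  -- least 5M/3 > |S|.
  set M := S.card + 1 with hM
  have hsub : Finset.Ioc (-(2 * M : ℤ)) (2 * M) ⊆ S ∪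
      ({k ∈ Finset.range M | (6 * k + 7).Prime}).biUnion fun k =>
        {n ∈ Finset.Ioc (-(2 * M : ℤ)) (2 * M) | ((6 * k + 7 : ℕ) : ℤ) ^ 2 ∣ sexticD n} := by
    intro n hn
    rw [Finset.mem_union]
    by_cases h : Squarefree (sexticD n)
    · left; rw [hS]; simpa using h
    · right
      obtain ⟨k, hk, hp, hd⟩ := exists_prime_sq_dvd_sexticD hn h
      exact Finset.mem_biUnion.2 ⟨k, Finset.mem_filter.2 ⟨Finset.mem_range.2 hk, hp⟩,
        Finset.mem_filter.2 ⟨hn, hd⟩⟩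
  have hcard := (Finset.card_le_card hsub).trans ((Finset.card_union_le _ _).trans
    (Nat.add_le_add_left Finset.card_biUnion_le _))
  rw [Int.card_Ioc, ← Nat.cast_le (α := ℚ)] at hcard
  have hlen : (2 * M - -(2 * M) : ℤ).toNat = 4 * M := by omega
  rw [hlen] at hcard
  push_cast at hcard
  have hterm : ∀ k ∈ ({k ∈ Finset.range M | (6 * k + 7).Prime} : Finset ℕ),
      (({n ∈ Finset.Ioc (-(2 * M : ℤ)) (2 * M) | ((6 * k + 7 : ℕ) : ℤ) ^ 2 ∣ sexticD n}.card : ℕ) : ℚ)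
        ≤ 8 * M * (1 / (6 * (k : ℚ) + 7) ^ 2) + 2 := fun k hk => by
    have := card_filter_sq_dvd_sexticD_le (Finset.mem_filter.1 hk).2
      (a := -(2 * M : ℤ)) (b := 2 * M) (by omega)
    refine this.trans (le_of_eq ?_)
    push_cast
    ring
  push_cast at hterm
  have h1 := hcard.trans (add_le_add_right (Finset.sum_le_sum hterm) _)
  have h2 : ∑ k ∈ ({k ∈ Finset.range M | (6 * k + 7).Prime} : Finset ℕ),
      (8 * (M : ℚ) * (1 / (6 * (k : ℚ) + 7) ^ 2) + 2) ≤
      ∑ k ∈ Finset.range M, (8 * (M : ℚ) * (1 / (6 * (k : ℚ) + 7) ^ 2) + 2) :=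
    Finset.sum_le_sum_of_subset_of_nonneg (Finset.filter_subset _ _) fun k _ _ => by positivity
  have hsum : ∑ k ∈ Finset.range M, (8 * (M : ℚ) * (1 / (6 * (k : ℚ) + 7) ^ 2) + 2) =
      8 * (M : ℚ) * ∑ k ∈ Finset.range M, (1 / (6 * (k : ℚ) + 7) ^ 2) + 2 * (M : ℚ) := by
    rw [Finset.sum_add_distrib, ← Finset.mul_sum]
    simp
    ring
  have h3 := sum_inv_sq_le M
  have h4 : (0 : ℚ) ≤ 1 / (6 * (6 * (M : ℚ) + 4)) := by positivity
  have h5 : 8 * (M : ℚ) * ∑ k ∈ Finset.range M, (1 / (6 * (k : ℚ) + 7) ^ 2) ≤ 8 * (M : ℚ) * (1 / 24) :=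
    mul_le_mul_of_nonneg_left (by linarith) (by positivity)
  have h6 : (M : ℚ) = S.card + 1 := by rw [hM]; push_cast; ring
  linarith

/-! ### The Galois group -/

section GaloisGroup

variable {L : Type*} [Field L]

/-- Square roots `θ₁, θ₂, θ₃` of the three roots of the cubic `g_n`, with product `1`; the last
condition expresses the second root of the cubic through the first one. -/
structure IsRootTriple (n : ℤ) (θ₁ θ₂ θ₃ : L) : Prop where
  sum_sq : θ₁ ^ 2 + θ₂ ^ 2 + θ₃ ^ 2 = -(3 * n + 4)
  sum_sq_mul_sq : θ₁ ^ 2 * θ₂ ^ 2 + θ₂ ^ 2 * θ₃ ^ 2 + θ₃ ^ 2 * θ₁ ^ 2 = 3 * n + 1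
  prod_eq_one : θ₁ * θ₂ * θ₃ = 1
  sq_eq : θ₂ ^ 2 = (θ₁ ^ 2) ^ 2 + (3 * n + 3) * θ₁ ^ 2 - 2

namespace IsRootTriple

variable {n : ℤ} {θ₁ θ₂ θ₃ : L}

theorem aeval_eq (h : IsRootTriple n θ₁ θ₂ θ₃) (x : L) :
    aeval x (evenSextic n) = (x ^ 2 - θ₁ ^ 2) * (x ^ 2 - θ₂ ^ 2) * (x ^ 2 - θ₃ ^ 2) := by
  rw [aeval_evenSextic]
  linear_combination x ^ 4 * h.sum_sq - x ^ 2 * h.sum_sq_mul_sq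
    + (θ₁ * θ₂ * θ₃ + 1) * h.prod_eq_one

theorem eq_or_of_aeval_eq_zero (h : IsRootTriple n θ₁ θ₂ θ₃) {x : L}
    (hx : aeval x (evenSextic n) = 0) :
    (x = θ₁ ∨ x = -θ₁) ∨ (x = θ₂ ∨ x = -θ₂) ∨ (x = θ₃ ∨ x = -θ₃) := by
  rw [h.aeval_eq, mul_eq_zero, mul_eq_zero, sub_eq_zero, sub_eq_zero, sub_eq_zero,
    sq_eq_sq_iff_eq_or_eq_neg, sq_eq_sq_iff_eq_or_eq_neg, sq_eq_sq_iff_eq_or_eq_neg] at hx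
  tauto

/-- The four sums `±θ₁ ± θ₂ ± θ₃` with an even number of minus signs. -/
def signedSum (θ₁ θ₂ θ₃ : L) : Fin 4 → L :=
  ![θ₁ + θ₂ + θ₃, θ₁ - θ₂ - θ₃, -θ₁ + θ₂ - θ₃, -θ₁ - θ₂ + θ₃]

/-- The quartic has rational coefficients because θ₁θ₂θ₃ = 1; this is what makes automorphisms
permute the signed sums. -/
theorem quartic_eq_zero_iff (h : IsRootTriple n θ₁ θ₂ θ₃) (x : L) :
    x ^ 4 + 2 * (3 * n + 4) * x ^ 2 - 8 * x + (9 * n ^ 2 + 12 * n + 12) = 0 ↔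
      ∃ j, signedSum θ₁ θ₂ θ₃ j = x := by
  have e : x ^ 4 + 2 * (3 * n + 4) * x ^ 2 - 8 * x + (9 * n ^ 2 + 12 * n + 12) =
      (x - (θ₁ + θ₂ + θ₃)) * (x - (θ₁ - θ₂ - θ₃)) * (x - (-θ₁ + θ₂ - θ₃)) *
        (x - (-θ₁ - θ₂ + θ₃)) := by
    linear_combination (2 * x ^ 2 - (θ₁ ^ 2 + θ₂ ^ 2 + θ₃ ^ 2) + (3 * n + 4)) * h.sum_sq
      + 4 * h.sum_sq_mul_sq + 8 * x * h.prod_eq_one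
  rw [e, mul_eq_zero, mul_eq_zero, mul_eq_zero, sub_eq_zero, sub_eq_zero, sub_eq_zero, sub_eq_zero,
    Fin.exists_fin_succ, Fin.exists_fin_succ, Fin.exists_fin_two]
  simp [signedSum, eq_comm (a := x), or_assoc]

variable [Algebra ℚ L]

theorem sq_ne_sq (h : IsRootTriple n θ₁ θ₂ θ₃) :
    θ₁ ^ 2 ≠ θ₂ ^ 2 ∧ θ₂ ^ 2 ≠ θ₃ ^ 2 ∧ θ₃ ^ 2 ≠ θ₁ ^ 2 := by
  have : CharZero L := algebraRat.charZero L
  have h1 : aeval (θ₁ ^ 2) (resolventCubic n) = 0 := by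
    have := h.aeval_eq θ₁
    rw [sub_self, zero_mul, zero_mul, aeval_evenSextic] at this
    rw [aeval_resolventCubic]
    linear_combination this
  have hV := resolventCubic_vandermonde h1
  have h3 : θ₃ ^ 2 = -(θ₁ ^ 2) ^ 2 - (3 * n + 4) * θ₁ ^ 2 - (3 * n + 2) := by
    linear_combination h.sum_sq - h.sq_eq
  rw [← h3, ← h.sq_eq] at hV
  have hD : ((sexticD n : ℤ) : L) ≠ 0 := by exact_mod_cast (sexticD_pos n).ne'
  refine ⟨fun e => hD ?_, fun e => hD ?_, fun e => hD ?_⟩ <;> rw [e] at hV <;>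
    simpa [eq_comm] using hV

theorem signedSum_injective (h : IsRootTriple n θ₁ θ₂ θ₃) :
    Function.Injective (signedSum θ₁ θ₂ θ₃) := by
  have : CharZero L := algebraRat.charZero L
  obtain ⟨h12, h23, h31⟩ := h.sq_ne_sq
  have key : ∀ {a b : L}, a ^ 2 ≠ b ^ 2 → 2 * (a + b) ≠ 0 ∧ 2 * (a - b) ≠ 0 := fun {a b} hab =>
    ⟨fun h0 => hab (by linear_combination (a - b) / 2 * h0),
      fun h0 => hab (by linear_combination (a + b) / 2 * h0)⟩
  obtain ⟨k1, k2⟩ := key h12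
  obtain ⟨k3, k4⟩ := key h23
  obtain ⟨k5, k6⟩ := key h31
  intro i j hij
  by_contra hne
  fin_cases i <;> fin_cases j <;> first
    | exact hne rfl
    | (simp [signedSum] at hij
       first
        | exact k1 (by linear_combination hij)
        | exact k1 (by linear_combination -hij)
        | exact k2 (by linear_combination hij)
        | exact k2 (by linear_combination -hij)
        | exact k3 (by linear_combination hij)
        | exact k3 (by linear_combination -hij)
        | exact k4 (by linear_combination hij)
        | exact k4 (by linear_combination -hij)
        | exact k5 (by linear_combination hij)
        | exact k5 (by linear_combination -hij)
        | exact k6 (by linear_combination hij)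
        | exact k6 (by linear_combination -hij))

/-- The Galois action on the four signed sums. -/
theorem exists_permutation_hom (h : IsRootTriple n θ₁ θ₂ θ₃) :
    ∃ φ : (L ≃ₐ[ℚ] L) →* Equiv.Perm (Fin 4), ∀ σ j,
      signedSum θ₁ θ₂ θ₃ (φ σ j) = σ (signedSum θ₁ θ₂ θ₃ j) := by
  let S : SubMulAction (L ≃ₐ[ℚ] L) L :=
    { carrier := {x | x ^ 4 + 2 * (3 * n + 4) * x ^ 2 - 8 * x + (9 * n ^ 2 + 12 * n + 12) = 0}
      smul_mem' := fun σ x hx => by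
        have := congrArg σ (show _ = _ from hx)
        simpa [map_ofNat] using this }
  let e : Fin 4 ≃ S := Equiv.ofBijective
    (fun j => ⟨signedSum θ₁ θ₂ θ₃ j, (h.quartic_eq_zero_iff _).2 ⟨j, rfl⟩⟩)
    ⟨fun i j hij => h.signedSum_injective (congrArg Subtype.val hij), fun x => by
      obtain ⟨j, hj⟩ := (h.quartic_eq_zero_iff x.1).1 x.2
      exact ⟨j, Subtype.ext hj⟩⟩
  refine ⟨(e.symm.permCongrHom).toMonoidHom.comp (MulAction.toPermHom (L ≃ₐ[ℚ] L) S),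
    fun σ j => ?_⟩
  have he : ∀ j, ((e j : S) : L) = signedSum θ₁ θ₂ θ₃ j := fun _ => rfl
  rw [← he, ← he]
  have : e (e.symm (σ • e j)) = σ • e j := e.apply_symm_apply _
  change ((e (e.symm (σ • e j)) : S) : L) = _
  rw [this]
  rfl

/-- A field generated by `θ₁, θ₂` whose automorphism group has order a multiple of `6`, but
not `6`, has automorphism group `A₄`. -/
theorem nonempty_mulEquiv_alternatingGroup (h : IsRootTriple n θ₁ θ₂ θ₃)
    (hgen : ∀ σ : L ≃ₐ[ℚ] L, σ θ₁ = θ₁ → σ θ₂ = θ₂ → σ = 1)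
    (h6 : 6 ∣ Nat.card (L ≃ₐ[ℚ] L)) (hne : Nat.card (L ≃ₐ[ℚ] L) ≠ 6) :
    Nonempty ((L ≃ₐ[ℚ] L) ≃* alternatingGroup (Fin 4)) := by
  have : CharZero L := algebraRat.charZero L
  obtain ⟨φ, hφ⟩ := h.exists_permutation_hom
  have hφ0 : ∀ σ, signedSum θ₁ θ₂ θ₃ (φ σ 0) = σ θ₁ + σ θ₂ + σ θ₃ := fun σ => by
    rw [hφ]; simp [signedSum]
  have hφ1 : ∀ σ, signedSum θ₁ θ₂ θ₃ (φ σ 1) = σ θ₁ - σ θ₂ - σ θ₃ := fun σ => by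
    rw [hφ]; simp [signedSum]
  have hφ2 : ∀ σ, signedSum θ₁ θ₂ θ₃ (φ σ 2) = -σ θ₁ + σ θ₂ - σ θ₃ := fun σ => by
    rw [hφ]; simp [signedSum]
  have hφ3 : ∀ σ, signedSum θ₁ θ₂ θ₃ (φ σ 3) = -σ θ₁ - σ θ₂ + σ θ₃ := fun σ => by
    rw [hφ]; simp [signedSum]
  have hinj : Function.Injective φ := by
    rw [injective_iff_map_eq_one]
    intro σ hσ
    have k0 := hφ0 σ
    have k1 := hφ1 σ
    have k2 := hφ2 σ
    simp [hσ, signedSum] at k0 k1 k2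
    exact hgen σ (by linear_combination (-1 / 2 : L) * (k0 + k1))
      (by linear_combination (-1 / 2 : L) * (k0 + k2))
  have hcard4 : Nat.card (Equiv.Perm (Fin 4)) = 24 := by
    rw [Nat.card_eq_fintype_card, Fintype.card_perm]; rfl
  have hdvd := Subgroup.card_dvd_of_injective φ hinj
  rw [hcard4] at hdvd
  have hrange : Nat.card φ.range = Nat.card (L ≃ₐ[ℚ] L) :=
    (Nat.card_congr (MonoidHom.ofInjective hinj).toEquiv).symm
  have hidx := φ.range.index_mul_card
  rw [hcard4, hrange] at hidx
  have hne24 : φ.range.index ≠ 1 := by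
    rw [Ne, Subgroup.index_eq_one, MonoidHom.range_eq_top]
    intro hsurj
    -- A preimage of this transposition fixes θ₁, hence θ₂² by `sq_eq`, yet sends θ₂ to -θ₃; this
    -- forces θ₂² = θ₃².
    obtain ⟨σ, hσ⟩ := hsurj (Equiv.swap 0 1)
    have s2 : (Equiv.swap (0 : Fin 4) 1) 2 = 2 := by decide
    have s3 : (Equiv.swap (0 : Fin 4) 1) 3 = 3 := by decide
    have k0 := hφ0 σ
    have k1 := hφ1 σ
    have k2 := hφ2 σ
    have k3 := hφ3 σ
    rw [hσ] at k0 k1 k2 k3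
    rw [Equiv.swap_apply_left] at k0
    rw [Equiv.swap_apply_right] at k1
    rw [s2] at k2
    rw [s3] at k3
    simp [signedSum] at k0 k1 k2 k3
    have f1 : σ θ₁ = θ₁ := by linear_combination (-1 / 2 : L) * (k0 + k1)
    have f2 : σ θ₂ = -θ₃ := by linear_combination (-1 / 4 : L) * (k0 - k1 + k2 - k3)
    have f3 := congrArg σ h.sq_eq
    simp [f1, f2, map_ofNat] at f3
    exact h.sq_ne_sq.2.1 (by rw [h.sq_eq, f3])
  have hidx2 : φ.range.index = 2 := by
    obtain ⟨k, hk⟩ := h6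
    rw [hk] at hidx hne
    have h4 : φ.range.index * k = 4 := by nlinarith
    have hk4 : φ.range.index ≤ 4 := Nat.le_of_dvd (by norm_num) ⟨k, h4.symm⟩
    -- The index divides 4; index 4 would mean order 6 and index 1 was just excluded.
    interval_cases φ.range.index <;> omega
  exact ⟨(MonoidHom.ofInjective hinj).trans
    (MulEquiv.subgroupCongr (Equiv.Perm.eq_alternatingGroup_of_index_eq_two hidx2))⟩

end IsRootTriple

variable [Algebra ℚ L]

/-- The roots of g_n have product 1, so once θ₁ and θ₂ are chosen, (θ₁θ₂)⁻¹ is a square root of the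
third. -/
theorem exists_isRootTriple {n : ℤ} (hs : ((overRat (evenSextic n)).map (algebraMap ℚ L)).Splits) :
    ∃ θ₁ θ₂ θ₃ : L, IsRootTriple n θ₁ θ₂ θ₃ := by
  have hm := (evenSextic_monic n).map (Int.castRingHom ℚ)
  obtain ⟨θ₁, h1⟩ := hs.exists_eval_eq_zero (by
    rw [degree_map, degree_eq_natDegree hm.ne_zero, (evenSextic_monic n).natDegree_map,
      evenSextic_natDegree]
    norm_num)
  rw [eval_map_algebraMap, aeval_overRat] at h1
  have hy : aeval (θ₁ ^ 2) (resolventCubic n) = 0 := by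
    rw [aeval_evenSextic] at h1
    rw [aeval_resolventCubic]
    linear_combination h1
  rw [aeval_resolventCubic] at hy
  set y := θ₁ ^ 2 with hyθ
  have hfac : (overRat (evenSextic n)).map (algebraMap ℚ L) =
      (X ^ 2 - C (y ^ 2 + (3 * n + 3) * y - 2)) *
        ((X ^ 2 - C y) * (X ^ 2 - C (-y ^ 2 - (3 * n + 4) * y - (3 * n + 2)))) := by
    have e2 : y * (y ^ 2 + (3 * n + 3) * y - 2) + (y ^ 2 + (3 * n + 3) * y - 2) *
        (-y ^ 2 - (3 * n + 4) * y - (3 * n + 2)) +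
        (-y ^ 2 - (3 * n + 4) * y - (3 * n + 2)) * y = 3 * n + 1 := by
      linear_combination (-3 - 3 * n - y) * hy
    have e3 : y * (y ^ 2 + (3 * n + 3) * y - 2) *
        (-y ^ 2 - (3 * n + 4) * y - (3 * n + 2)) = 1 := by
      linear_combination (1 - (3 + 3 * n) * y - y ^ 2) * hy
    have e2' := congrArg (C : L → L[X]) e2
    have e3' := congrArg (C : L → L[X]) e3
    have hE : evenSextic n =
        X ^ 6 + (3 * (n : ℤ[X]) + 4) * X ^ 4 + (3 * (n : ℤ[X]) + 1) * X ^ 2 - 1 := by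
      simp [evenSextic]
    rw [hE]
    have c2 : (C 2 : L[X]) = 2 := map_ofNat C 2
    have c3 : (C 3 : L[X]) = 3 := map_ofNat C 3
    have c4 : (C 4 : L[X]) = 4 := map_ofNat C 4
    simp [c2, c3, c4] at e2' e3' ⊢
    linear_combination (-X ^ 2) * e2' + e3'
  obtain ⟨θ₂, h2⟩ := (hs.of_dvd (hm.map _).ne_zero ⟨_, hfac⟩).exists_eval_eq_zero (by
    rw [degree_X_pow_sub_C two_pos]; norm_num)
  simp only [eval_sub, eval_pow, eval_X, eval_C, sub_eq_zero] at h2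
  have e2 : y * (y ^ 2 + (3 * n + 3) * y - 2) * (-y ^ 2 - (3 * n + 4) * y - (3 * n + 2)) = 1 := by
    linear_combination (1 - (3 + 3 * n) * y - y ^ 2) * hy
  have hne : θ₁ * θ₂ ≠ 0 := by
    intro h0
    have : (θ₁ * θ₂) ^ 2 * (-y ^ 2 - (3 * n + 4) * y - (3 * n + 2)) = 1 := by
      rw [mul_pow, ← hyθ, h2, e2]
    rw [h0] at this
    norm_num at this
  have h3 : ((θ₁ * θ₂)⁻¹) ^ 2 = -y ^ 2 - (3 * n + 4) * y - (3 * n + 2) := by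
    rw [inv_pow, mul_pow, ← hyθ, h2]
    exact inv_eq_of_mul_eq_one_right e2
  refine ⟨θ₁, θ₂, (θ₁ * θ₂)⁻¹, ?_, ?_, mul_inv_cancel₀ hne, h2⟩
  · rw [h3, h2, ← hyθ]; ring
  · rw [h3, h2, ← hyθ]; linear_combination (-3 - 3 * n - y) * hy

/-- g_n(-1) = 1 and g_n(0) = -1 give a root y in (-1, 0), whose square roots are imaginary; its
conjugate -(1+y)/y is nonnegative and has a real square root. -/
theorem exists_real_roots (n : ℤ) : ∃ r s : ℝ, aeval (r : ℂ) (evenSextic n) = 0 ∧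
    aeval (s * Complex.I) (evenSextic n) = 0 ∧ s ≠ 0 := by
  obtain ⟨y, ⟨hy1, hy0⟩, hy⟩ : (0 : ℝ) ∈ (fun y : ℝ =>
      y ^ 3 + (3 * n + 4) * y ^ 2 + (3 * n + 1) * y - 1) '' Set.Icc (-1) 0 :=
    intermediate_value_Icc' (by norm_num) (by fun_prop) ⟨by norm_num, by ring_nf; norm_num⟩
  have hg : aeval y (resolventCubic n) = 0 := by rw [aeval_resolventCubic]; exact hy
  have hg3 := (resolventCubic_conj hg).2
  set y₃ := -y ^ 2 - (3 * n + 4) * y - (3 * n + 2) with hy₃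
  have hyne : y ≠ 0 := by rintro rfl; norm_num at hy
  have hneg : y < 0 := lt_of_le_of_ne hy0 hyne
  have hrel : y * y₃ = -(1 + y) := by rw [hy₃]; linear_combination -hy
  have h3 : 0 ≤ y₃ := by
    by_contra hlt
    push Not at hlt
    nlinarith [mul_pos_of_neg_of_neg hneg hlt]
  have real_eq : ∀ x : ℝ, aeval x (resolventCubic n) = 0 →
      (x : ℂ) ^ 3 + (3 * n + 4) * (x : ℂ) ^ 2 + (3 * n + 1) * (x : ℂ) - 1 = 0 := fun x hx => by
    rw [aeval_resolventCubic] at hx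
    exact_mod_cast congrArg (Complex.ofReal) hx
  refine ⟨√y₃, √(-y), ?_, ?_, (Real.sqrt_pos.2 (by linarith)).ne'⟩
  · have hsq : ((√y₃ : ℝ) : ℂ) ^ 2 = y₃ := by exact_mod_cast congrArg Complex.ofReal (Real.sq_sqrt h3)
    rw [aeval_evenSextic]
    have := real_eq _ hg3
    rw [← hsq] at this
    linear_combination this
  · have hsq : (((√(-y) : ℝ) : ℂ) * Complex.I) ^ 2 = y := by
      rw [mul_pow, Complex.I_sq]
      have : ((√(-y) : ℝ) : ℂ) ^ 2 = ((-y : ℝ) : ℂ) := by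
        exact_mod_cast congrArg Complex.ofReal (Real.sq_sqrt (by linarith))
      rw [this]; push_cast; ring
    rw [aeval_evenSextic]
    have := real_eq _ hg
    rw [← hsq] at this
    linear_combination this

theorem finrank_adjoin_root_evenSextic {n : ℤ} {t : L} (ht : aeval t (evenSextic n) = 0) :
    Module.finrank ℚ ℚ⟮t⟯ = 6 := by
  have hint : IsIntegral ℚ t := ⟨overRat (evenSextic n), (evenSextic_monic n).map _, by
    rw [← aeval_def, aeval_overRat, ht]⟩
  rw [adjoin.finrank hint,
    minpoly_rat_eq_overRat (evenSextic_monic n) (evenSextic_irreducible n) ht,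
    (evenSextic_monic n).natDegree_map, evenSextic_natDegree]

/-- In degree 6 a root t with real image generates L, so the image of L in ℂ would be real; but L
contains all roots of f_n, including an imaginary one. -/
theorem IsRootTriple.finrank_ne_six [FiniteDimensional ℚ L] {n : ℤ} {θ₁ θ₂ θ₃ : L}
    (h : IsRootTriple n θ₁ θ₂ θ₃) : Module.finrank ℚ L ≠ 6 := by
  intro h6
  obtain ⟨r, s, hr, hs, hs0⟩ := exists_real_roots n
  let ι : L →ₐ[ℚ] ℂ := IsAlgClosed.lift
  have hι : IsRootTriple n (ι θ₁) (ι θ₂) (ι θ₃) := by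
    refine ⟨?_, ?_, ?_, ?_⟩
    · simpa [map_ofNat] using congrArg ι h.sum_sq
    · simpa [map_ofNat] using congrArg ι h.sum_sq_mul_sq
    · simpa [map_ofNat] using congrArg ι h.prod_eq_one
    · simpa [map_ofNat] using congrArg ι h.sq_eq
  have hrange : ∀ x : ℂ, aeval x (evenSextic n) = 0 → ∃ t : L, ι t = x := fun x hx => by
    rcases hι.eq_or_of_aeval_eq_zero hx with (h | h) | (h | h) | (h | h)
    exacts [⟨_, h.symm⟩, ⟨-θ₁, by rw [map_neg, h]⟩, ⟨_, h.symm⟩, ⟨-θ₂, by rw [map_neg, h]⟩,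
      ⟨_, h.symm⟩, ⟨-θ₃, by rw [map_neg, h]⟩]
  obtain ⟨t, ht⟩ := hrange _ hr
  obtain ⟨u, hu⟩ := hrange _ hs
  have ht0 : aeval t (evenSextic n) = 0 := by
    apply ι.injective
    rw [map_zero, ← hr, ← ht, aeval_evenSextic, aeval_evenSextic]
    simp [map_ofNat]
  have htop : ℚ⟮t⟯ = ⊤ := by
    apply IntermediateField.eq_of_le_of_finrank_eq le_top
    rw [finrank_adjoin_root_evenSextic ht0, IntermediateField.finrank_top', h6]
  have hle : ℚ⟮t⟯ ≤ (IsScalarTower.toAlgHom ℚ ℝ ℂ).fieldRange.comap ι := by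
    rw [adjoin_simple_le_iff]
    exact ⟨r, ht.symm⟩
  rw [htop] at hle
  obtain ⟨v, hv⟩ : ι u ∈ (IsScalarTower.toAlgHom ℚ ℝ ℂ).fieldRange := hle (mem_top (x := u))
  rw [hu] at hv
  have := congrArg Complex.im hv
  simp at this
  exact hs0 this.symm

end GaloisGroup

theorem hasGaloisGroupA4_evenSextic (n : ℤ) : HasGaloisGroupA4 (evenSextic n) := by
  have hirr := overRat_irreducible (evenSextic_monic n) (evenSextic_irreducible n)
  obtain ⟨θ₁, θ₂, θ₃, h⟩ := exists_isRootTriple (SplittingField.splits (overRat (evenSextic n)))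
  have hcard : Nat.card (overRat (evenSextic n)).Gal =
      Module.finrank ℚ (overRat (evenSextic n)).SplittingField :=
    Gal.card_of_separable hirr.separable
  refine h.nonempty_mulEquiv_alternatingGroup (fun σ h1 h2 => ?_) ?_ ?_
  · have h3 : σ θ₃ = θ₃ := by
      have e := congrArg σ h.prod_eq_one
      rw [map_mul, map_mul, h1, h2, map_one, ← h.prod_eq_one] at e
      refine mul_left_cancel₀ (fun h0 => ?_) e
      have := h.prod_eq_one
      rw [h0, zero_mul] at this
      exact zero_ne_one this
    refine Gal.ext (overRat (evenSextic n)) (σ := σ) (τ := 1) fun x hx => ?_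
    have hx0 := aeval_eq_zero_of_mem_rootSet hx
    rw [aeval_overRat] at hx0
    change σ x = x
    rcases h.eq_or_of_aeval_eq_zero hx0 with (rfl | rfl) | (rfl | rfl) | (rfl | rfl) <;>
      simp only [map_neg, h1, h2, h3]
  · change 6 ∣ Nat.card (overRat (evenSextic n)).Gal
    -- The splitting field contains the degree 6 field ℚ(θ₁); apply the tower law.
    rw [hcard, ← finrank_adjoin_root_evenSextic (t := θ₁) (n := n) (by rw [h.aeval_eq]; ring)]
    exact ⟨_, (Module.finrank_mul_finrank ℚ ℚ⟮θ₁⟯ _).symm⟩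
  · change Nat.card (overRat (evenSextic n)).Gal ≠ 6
    rw [hcard]
    exact h.finrank_ne_six

theorem theorem4p1 :
    (∀ n : ℤ, Irreducible (overRat (evenSextic n)) ∧ HasGaloisGroupA4 (evenSextic n)) ∧
    (∀ n : ℤ, IsMonogenicPoly (evenSextic n) ↔ Squarefree (sexticD n)) ∧
    (squarefreeFamily.Infinite ∧
      (∀ f ∈ squarefreeFamily,
        IsMonogenicPoly f ∧ HasGaloisGroupA4 f ∧ IsEvenSexticQuadrinomial f) ∧
      (∀ f ∈ squarefreeFamily, ∀ g ∈ squarefreeFamily, f ≠ g → ¬ GenerateSameField f g)) := by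
  refine ⟨fun n => ⟨overRat_irreducible (evenSextic_monic n) (evenSextic_irreducible n),
    hasGaloisGroupA4_evenSextic n⟩, isMonogenicPoly_evenSextic_iff, ?_, ?_, ?_⟩
  · refine (infinite_squarefree_sexticD.image evenSextic_injective.injOn).mono ?_
    rintro _ ⟨n, hn, rfl⟩
    exact ⟨n, hn, rfl⟩
  · rintro _ ⟨n, hn, rfl⟩
    exact ⟨isMonogenicPoly_evenSextic_of_squarefree hn, hasGaloisGroupA4_evenSextic n,
      evenSextic_isEvenSexticQuadrinomial n⟩
  · rintro _ ⟨n, hn, rfl⟩ _ ⟨m, hm, rfl⟩ hne h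
    exact hne (congrArg evenSextic (eq_of_generateSameField hn hm h))
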